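/- Let $k$ be an algebraically closed field of characteristic zero, let $X\subset\mathbf P^r_k$ be a smooth projective variety of dimension $n$, and let $\pi\colon X\to\mathbf P^{n+1}_k$ be a linear projection from a linear subspace of $\mathbf P^r$ of codimension $n+2$ that does not meet $X$; that is, $\pi$ is given by $n+2$ linearly independent linear forms with no common zero on $X$. Let $p\in X$ be a (closed) point at which $\pi$ has corank $d$, meaning that the map induced by $\pi$ on Zariski tangent spaces at $p$ has rank $n-d$. Then the scheme-theoretic fiber $\pi^{-1}(\pi(p))$ is a finite $k$-scheme, and its degree $\dim_k\Gamma\bigl(\pi^{-1}(\pi(p)),\mathcal O\bigr)$ is at least $$\binom{d+1}{\lceil d/2\rceil}.$$ -/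

import Mathlib

open CategoryTheory AlgebraicGeometry

universe u

noncomputable section

namespace LinProj

section ProjectiveSpace

attribute [local instance] MvPolynomial.gradedAlgebra

/-- The grading by degree of the polynomial ring `k[X 0, …, X N]`. -/
abbrev grading (k : Type u) [Field k] (N : ℕ) : ℕ → Submodule k (MvPolynomial (Fin (N + 1)) k) :=
  MvPolynomial.homogeneousSubmodule (Fin (N + 1)) k

/-- Projective `N`-space over `k`, with homogeneous coordinates `X 0, …, X N`. -/
abbrev PSpace (k : Type u) [Field k] (N : ℕ) : Scheme.{u} :=
  Proj (grading k N)

/-- The structure morphism of projective space over `k`. -/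
def PSpace.toSpec (k : Type u) [Field k] (N : ℕ) : PSpace k N ⟶ Spec (.of k) :=
  Proj.toSpecZero (grading k N) ≫
    Spec.map (CommRingCat.ofHom (algebraMap k (grading k N 0)))

variable {k : Type u} [Field k] {r m : ℕ}

/-- The linear form `∑ j, a j * X j`. -/
def linForm (a : Fin (r + 1) → k) : MvPolynomial (Fin (r + 1)) k :=
  ∑ j, MvPolynomial.C (a j) * MvPolynomial.X j

lemma linForm_mem (a : Fin (r + 1) → k) : linForm a ∈ grading k r 1 :=
  Submodule.sum_mem _ fun j _ ↦ (MvPolynomial.isHomogeneous_C_mul_X (a j) j)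

lemma X_mem (k : Type u) [Field k] {N : ℕ} (i : Fin (N + 1)) :
    MvPolynomial.X i ∈ grading k N 1 :=
  MvPolynomial.isHomogeneous_X k i

/-- The homogeneous `k`-algebra homomorphism `k[y₀, …, yₘ] → k[x₀, …, xᵣ]` sending `yᵢ` to the
linear form with coefficients `L i`. -/
def coordHom (L : Fin (m + 1) → Fin (r + 1) → k) : grading k m →ₐᵍ[k] grading k r where
  __ := MvPolynomial.aeval (R := k) fun i ↦ linForm (L i)
  map_mem {i x} hx := by
    have h := MvPolynomial.IsHomogeneous.aeval (n := 1) (φ := x) (m := i) hx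
      (fun i ↦ linForm (L i)) (fun i ↦ linForm_mem (L i))
    simpa using h

lemma coordHom_X (L : Fin (m + 1) → Fin (r + 1) → k) (i : Fin (m + 1)) :
    coordHom L (MvPolynomial.X i) = linForm (L i) :=
  MvPolynomial.aeval_X _ i

/-- The open subset `D₊(ℓ)` of projective space where the linear form `ℓ` with coefficients `a`
does not vanish. -/
def nonvanishing (a : Fin (r + 1) → k) : (PSpace k r).Opens :=
  Proj.basicOpen (grading k r) (linForm a)

/-- The centre of the projection given by linear forms: the linear subspace where all of the
forms vanish. -/
def center (L : Fin (m + 1) → Fin (r + 1) → k) : Set (PSpace k r) :=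
  {x | ∀ i, x ∉ nonvanishing (L i)}

/-- The open complement of the centre. -/
def centerCompl (L : Fin (m + 1) → Fin (r + 1) → k) : (PSpace k r).Opens :=
  ⨆ i, nonvanishing (L i)

lemma nonvanishing_le (L : Fin (m + 1) → Fin (r + 1) → k) (i : Fin (m + 1)) :
    nonvanishing (L i) ≤ centerCompl L :=
  le_iSup (fun i ↦ nonvanishing (L i)) i

lemma coe_centerCompl (L : Fin (m + 1) → Fin (r + 1) → k) :
    (centerCompl L : Set (PSpace k r)) = (center L)ᶜ := by
  ext x
  simp [centerCompl, center]

/-- For homogeneous `f` of positive degree in `k[y₀, …, yₘ]`, the morphism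
`D₊(φ f) ⟶ D₊(f) ⊆ ℙᵐ` induced by the ring homomorphism `k[y]_(f) → k[x]_(φ f)`, where `φ`
substitutes the linear forms for the variables. -/
def projectionAway (L : Fin (m + 1) → Fin (r + 1) → k) {d : ℕ}
    (f : MvPolynomial (Fin (m + 1)) k) (hf : f ∈ grading k m d) (hd : 0 < d) :
    (Proj.basicOpen (grading k r) (coordHom L f)).toScheme ⟶ PSpace k m :=
  Proj.basicOpenToSpec (grading k r) (coordHom L f) ≫
    Spec.map (CommRingCat.ofHom
      (HomogeneousLocalization.Away.map (coordHom L).toGradedRingHom f)) ≫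
    Proj.awayι (grading k m) f hf hd

lemma homOfLE_projectionAway (L : Fin (m + 1) → Fin (r + 1) → k) {d e c : ℕ}
    (f g x : MvPolynomial (Fin (m + 1)) k)
    (hf : f ∈ grading k m d) (hd : 0 < d) (hg : g ∈ grading k m e) (hx : x = f * g)
    (hx' : x ∈ grading k m c) (hc : 0 < c)
    (h : Proj.basicOpen (grading k r) (coordHom L x) ≤
      Proj.basicOpen (grading k r) (coordHom L f)) :
    (Proj (grading k r)).homOfLE h ≫ projectionAway L f hf hd =
      projectionAway L x hx' hc := by
  have hφ : coordHom L x = coordHom L f * coordHom L g := by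
    rw [hx]; exact map_mul (coordHom L) f g
  have h1 := Proj.basicOpenToSpec_SpecMap_awayMap (grading k r) (f := coordHom L f)
    (g := coordHom L g) ((coordHom L).map_mem hg) (x := coordHom L x) hφ
  have h2 := Proj.SpecMap_awayMap_awayι (grading k m) (f := f) (g := g) hf hd hg hx
  have h3 : (HomogeneousLocalization.awayMap (grading k r) ((coordHom L).map_mem hg) hφ).comp
      (HomogeneousLocalization.Away.map (coordHom L).toGradedRingHom f) =
      (HomogeneousLocalization.Away.map (coordHom L).toGradedRingHom x).comp
        (HomogeneousLocalization.awayMap (grading k m) hg hx) := by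
    ext a
    obtain ⟨n, a, ha, rfl⟩ := a.mk_surjective _ hf
    have e1 := HomogeneousLocalization.awayMap_mk (𝒜 := grading k r) (f := coordHom L f)
      (hf := (coordHom L).map_mem hf) (hg := (coordHom L).map_mem hg) (hx := hφ)
      (n := n) (a := coordHom L a) (ha := (coordHom L).map_mem ha)
    have e2 := HomogeneousLocalization.awayMap_mk (𝒜 := grading k m) (hf := hf) (n := n)
      (a := a) (ha := ha) (hg := hg) (hx := hx)
    rw [RingHom.comp_apply, RingHom.comp_apply, e2, HomogeneousLocalization.Away.map_mk,
      HomogeneousLocalization.Away.map_mk]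
    refine (congrArg _ e1).trans ?_
    simp only [HomogeneousLocalization.Away.val_mk]
    congr 1
    exact ((map_mul (coordHom L) a (g ^ n)).trans (by rw [map_pow]; rfl)).symm
  have h4 : Proj.awayι (grading k m) x hx' hc =
      Spec.map (CommRingCat.ofHom (HomogeneousLocalization.awayMap (grading k m) hg hx)) ≫
        Proj.awayι (grading k m) f hf hd := h2.symm
  unfold projectionAway
  rw [h4, ← reassoc_of% h1, ← Spec.map_comp_assoc, ← Spec.map_comp_assoc, ← CommRingCat.ofHom_comp,
    ← CommRingCat.ofHom_comp, h3]

lemma basicOpen_coordHom_X (L : Fin (m + 1) → Fin (r + 1) → k) (i : Fin (m + 1)) :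
    nonvanishing (L i) = Proj.basicOpen (grading k r) (coordHom L (MvPolynomial.X i)) := by
  rw [coordHom_X]; rfl

/-- The morphism `D₊(ℓᵢ) ⟶ ℙᵐ` with image in `D₊(yᵢ)` given by `yⱼ / yᵢ ↦ ℓⱼ / ℓᵢ`. -/
def projectionPiece (L : Fin (m + 1) → Fin (r + 1) → k) (i : Fin (m + 1)) :
    (nonvanishing (L i)).toScheme ⟶ PSpace k m :=
  (PSpace k r).homOfLE (basicOpen_coordHom_X L i).le ≫
    projectionAway L (MvPolynomial.X i) (X_mem k i) one_pos

lemma projectionPiece_compat (L : Fin (m + 1) → Fin (r + 1) → k) (i j : Fin (m + 1)) :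
    (PSpace k r).homOfLE (inf_le_left : nonvanishing (L i) ⊓ nonvanishing (L j) ≤ _) ≫
      projectionPiece L i =
    (PSpace k r).homOfLE (inf_le_right : nonvanishing (L i) ⊓ nonvanishing (L j) ≤ _) ≫
      projectionPiece L j := by
  have hi := MvPolynomial.isHomogeneous_X k i
  have hj := MvPolynomial.isHomogeneous_X k j
  have key : nonvanishing (L i) ⊓ nonvanishing (L j) =
      Proj.basicOpen (grading k r) (coordHom L (MvPolynomial.X i * MvPolynomial.X j)) := by
    rw [basicOpen_coordHom_X, basicOpen_coordHom_X, ← Proj.basicOpen_mul]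
    exact congrArg _ (map_mul (coordHom L) _ _).symm
  have h1 := homOfLE_projectionAway L (MvPolynomial.X i) (MvPolynomial.X j) _ hi one_pos hj rfl
    (hi.mul hj) two_pos (key.symm.le.trans (inf_le_left.trans (basicOpen_coordHom_X L i).le))
  have h2 := homOfLE_projectionAway L (MvPolynomial.X j) (MvPolynomial.X i) _ hj one_pos hi
    (mul_comm _ _)
    (hi.mul hj) two_pos (key.symm.le.trans (inf_le_right.trans (basicOpen_coordHom_X L j).le))
  have h3 := h1.trans h2.symm
  rw [← cancel_epi ((PSpace k r).isoOfEq key).inv]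
  simpa [projectionPiece, Scheme.isoOfEq_inv, Scheme.homOfLE_homOfLE_assoc] using h3

/-- The linear projection `ℙʳ ∖ Σ ⟶ ℙᵐ`, `x ↦ [ℓ₀(x) : … : ℓₘ(x)]`, where `ℓᵢ` is the linear form
with coefficients `L i` and `Σ` is the common zero locus of the `ℓᵢ`. It is glued from the
morphisms `D₊(ℓᵢ) ⟶ D₊(yᵢ)` given by `yⱼ / yᵢ ↦ ℓⱼ / ℓᵢ`. -/
def projection (L : Fin (m + 1) → Fin (r + 1) → k) : (centerCompl L).toScheme ⟶ PSpace k m :=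
  (Scheme.Opens.iSupOpenCover fun i ↦ nonvanishing (L i)).glueMorphisms (projectionPiece L)
    (by
      intro i j
      let e := (isPullback_opens_inf_le (le_iSup (fun i ↦ nonvanishing (L i)) i)
        (le_iSup (fun i ↦ nonvanishing (L i)) j)).isoPullback
      refine (cancel_epi e.hom).mp ?_
      exact (by simpa [e] using projectionPiece_compat L i j :
        e.hom ≫ Limits.pullback.fst _ _ ≫ projectionPiece L i =
          e.hom ≫ Limits.pullback.snd _ _ ≫ projectionPiece L j))

lemma homOfLE_projection (L : Fin (m + 1) → Fin (r + 1) → k) (i : Fin (m + 1)) :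
    (PSpace k r).homOfLE (nonvanishing_le L i) ≫ projection L =
      projectionPiece L i :=
  (Scheme.Opens.iSupOpenCover fun i ↦ nonvanishing (L i)).ι_glueMorphisms _ _ i

/-- The restriction to `ι : X ⟶ ℙʳ` of the linear projection given by the linear forms with
coefficients `L i`, when `X` does not meet the centre. -/
def projectionOn (L : Fin (m + 1) → Fin (r + 1) → k) {X : Scheme.{u}} (ι : X ⟶ PSpace k r)
    (h : Disjoint (Set.range ι) (center L)) : X ⟶ PSpace k m :=
  IsOpenImmersion.lift (centerCompl L).ι ι
    (by
      rw [Scheme.Opens.range_ι, coe_centerCompl]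
      exact Set.disjoint_compl_right_iff_subset.mp (by simpa using h)) ≫
    projection L

end ProjectiveSpace

section Tangent

open IsLocalRing

variable {A B : Type u} [CommRing A] [CommRing B] [IsLocalRing A] [IsLocalRing B]

lemma maximalIdeal_le_comap (f : A →+* B) [IsLocalHom f] :
    maximalIdeal A ≤ (maximalIdeal B).comap f.toIntAlgHom :=
  have h : maximalIdeal A ≤ (maximalIdeal B).comap f := ((local_hom_TFAE f).out 0 3).mp ‹_›
  fun _ ha ↦ h ha

/-- The pullback map on cotangent spaces `𝔪_A / 𝔪_A² → 𝔪_B / 𝔪_B²` induced by a local ring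
homomorphism `A → B`, semilinear over the map of residue fields. -/
def cotangentMap (f : A →+* B) [IsLocalHom f] :
    CotangentSpace A →ₛₗ[ResidueField.map f] CotangentSpace B where
  __ := (Ideal.mapCotangent (maximalIdeal A) (maximalIdeal B) f.toIntAlgHom
    (maximalIdeal_le_comap f)).toAddMonoidHom
  map_smul' c x := by
    obtain ⟨a, rfl⟩ := residue_surjective c
    obtain ⟨x, rfl⟩ := Ideal.toCotangent_surjective _ x
    have h1 : residue A a • (maximalIdeal A).toCotangent x =
        (maximalIdeal A).toCotangent (a • x) := by
      rw [map_smul, ← algebraMap_smul (ResidueField A) a]; rfl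
    have h2 (y : CotangentSpace B) : ResidueField.map f (residue A a) • y = f a • y := by
      rw [← algebraMap_smul (ResidueField B) (f a)]; rfl
    rw [h1, h2]
    change (maximalIdeal B).toCotangent ⟨f (a * x), maximalIdeal_le_comap f (a • x).2⟩ =
      f a • (maximalIdeal B).toCotangent ⟨f x, maximalIdeal_le_comap f x.2⟩
    rw [← map_smul]
    congr 1
    exact Subtype.ext (map_mul f a x)

/-- The differential of `Spec B ⟶ Spec A` at the closed points, from the Zariski tangent space
`(𝔪_B / 𝔪_B²)^∨` to the tangent space `Hom(𝔪_A / 𝔪_A², κ(B))` of `Spec A` at the image, base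
changed to the residue field `κ(B)`: the transpose of the pullback of cotangent vectors. -/
def tangentMap (f : A →+* B) [IsLocalHom f] :
    Module.Dual (ResidueField B) (CotangentSpace B) →ₗ[ResidueField B]
      (CotangentSpace A →ₛₗ[ResidueField.map f] ResidueField B) where
  toFun v := v.comp (cotangentMap f)
  map_add' _ _ := rfl
  map_smul' _ _ := rfl

/-- The rank at `p` of the map induced by `π` on Zariski tangent spaces. -/
def tangentRank {X Y : Scheme.{u}} (π : X ⟶ Y) (p : X) : ℕ :=
  Module.finrank (ResidueField (X.presheaf.stalk p))
    (LinearMap.range (tangentMap (π.stalkMap p).hom))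

end Tangent

/-- The degree of a finite `k`-scheme `Z`: the dimension over `k` of `Γ(Z, 𝒪_Z)`. -/
def degree {k : Type u} [Field k] {Z : Scheme.{u}} (s : Z ⟶ Spec (.of k)) : ℕ :=
  letI : Algebra k Γ(Z, ⊤) := ((Scheme.ΓSpecIso (.of k)).inv ≫ s.appTop).hom.toAlgebra
  Module.finrank k Γ(Z, ⊤)

end LinProj
end

/-!
The proof bounds the degree of the fiber from below by a piece of it concentrated at `p`, and bounds
the length of that piece by deforming its equations to explicit quadrics.

*Reduction to algebra.* The projection is finite (`LinProj.isFinite_projectionOn`): it is proper, and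
the preimages of the charts `D₊(yᵢ)` are the affine sets `D₊(ℓᵢ) ∩ X`. So the fiber is a finite
`k`-scheme. Let `R` be the local ring at `p`. The fiber near `p` is cut out by the images
`f 0, …, f n` in `R` of the `n + 1` generators of the maximal ideal at `π p`
(`LinProj.exists_span_eq_maximalIdeal_stalk`), and the corank of `π` is `d` exactly when the
`f i` have only `n - d` independent differentials
(`LinProj.finrank_range_tangentMap_eq_finrank_span`). Every quotient of `R` in which the `f i` vanish,
if finite over `k`, is a closed subscheme of the fiber (`LinProj.exists_closedImmersion_fiber`), so
the dimension of such a quotient bounds the degree.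

*The quotient.* Smoothness is used only through formal smoothness of `R` over `k` and the dimension
of its cotangent space. Formal smoothness gives a surjection from `R` to polynomials in `n` variables
truncated at any order, with coordinates of choice (`exists_surjective_truncated`). Choose `n - d` of
the coordinates to be combinations of the `f i` and set them to zero; what remains of the `f i` are
`d + 1` elements of order at least two in a truncated polynomial ring in `d` variables
(`exists_ideal_choose_le_finrank`).

*Deformation to squares.* Let `T` be the polynomial ring in `d` variables `x_i` truncated above degree
`t = ⌊d / 2⌋ + 1`. Among `d + 1` elements of order at least two, the quadrics `x_i ^ 2` and
`(∑ x_i) ^ 2` generate an ideal of maximal dimension (`MvPolynomial.choose_le_finrank_quotient`). In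
fact the syzygies of these quadrics in `T` are Koszul up to elements that kill everything of
order two, so in the pencil joining the quadrics to other elements `h` they deform along with the
pencil, and semicontinuity of ranks compares the general member with both ends
(`finrank_quotient_span_le_of_koszul`). That the syzygies are Koszul amounts to injectivity of
multiplication by `(∑ x_i) ^ 2` on `k[x] / (x_i ^ 2)` in degrees below the middle. In the basis of
squarefree monomials this is the strong Lefschetz property of the Boolean lattice
(`eq_zero_of_booleanUp_pow_eq_zero`), where characteristic zero enters.

*The count.* The quotient of `T` by the quadrics has dimension at least the number of squarefree
monomials of degree at most `t` less those of degree at most `t - 2`, that is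
`C(d, t) + C(d, t - 1) = C(d + 1, t)`, and `C(d + 1, ⌊d / 2⌋ + 1) = C(d + 1, ⌈d / 2⌉)`.
-/

/-! ### Ranks in pencils and Koszul relations -/

noncomputable section

open Module

/-- Rank is lower semicontinuous along a pencil of linear maps: it drops only where `-s⁻¹` is an
eigenvalue of the compression of `B` to the range of `A`. -/
theorem LinearMap.finite_setOf_finrank_range_add_smul_lt {k V W : Type*} [Field k]
    [AddCommGroup V] [Module k V] [AddCommGroup W] [Module k W] [FiniteDimensional k W]
    (A B : V →ₗ[k] W) :
    {s : k | finrank k (range (A + s • B)) < finrank k (range A)}.Finite := by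
  obtain ⟨i, hi⟩ := A.rangeRestrict.exists_rightInverse_of_surjective A.range_rangeRestrict
  obtain ⟨q, hq⟩ := (range A).subtype.exists_leftInverse_of_injective (range A).ker_subtype
  have hi' (x) : A (i x) = x := congr(($hi x : W))
  have hq' (x : range A) : q x = x := congr($hq x)
  set N : End k (range A) := q ∘ₗ B ∘ₗ i
  refine ((End.finite_spectrum N).image fun μ ↦ -μ⁻¹).subset fun s hs ↦ ?_
  by_contra hcon
  refine not_lt_of_ge ?_ (by simpa using hs)
  have hinj : Function.Injective (q ∘ₗ (A + s • B) ∘ₗ i) := by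
    rw [← ker_eq_bot, ker_eq_bot']
    intro x hx
    have hx' : x + s • N x = 0 := by simpa [hi', hq', N] using hx
    by_contra hx0
    have hs0 : s ≠ 0 := by rintro rfl; simp at hx'; exact hx0 hx'
    refine hcon ⟨-s⁻¹, ?_, by simp⟩
    refine End.HasEigenvalue.mem_spectrum
      (End.hasEigenvalue_of_hasEigenvector (x := x) ⟨End.mem_eigenspace_iff.mpr ?_, hx0⟩)
    rw [neg_smul, eq_neg_iff_add_eq_zero, ← smul_right_injective _ hs0 |>.eq_iff]
    simpa [smul_smul, hs0, add_comm] using hx'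
  have hinj' : Function.Injective ((A + s • B) ∘ₗ i) := by
    rw [coe_comp] at hinj
    exact hinj.of_comp
  rw [← finrank_range_of_inj hinj']
  exact Submodule.finrank_mono (range_comp_le_range _ _)

/-- Let `M s ∘ K s = 0` for all members of two pencils `K₀ + s K₁` and `M₀ + s M₁`, with exactness
at `s = 0`. For general `s` the ranks of `K s` and `M s` are at least those of `K₀` and of `M₁` (the
member at infinity), and they sum to at most `dim V = rank K₀ + rank M₀`. -/
theorem LinearMap.finrank_range_le_of_pencil_complex {k U V W : Type*} [Field k] [Infinite k]
    [AddCommGroup U] [Module k U]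
    [AddCommGroup V] [Module k V] [FiniteDimensional k V]
    [AddCommGroup W] [Module k W] [FiniteDimensional k W]
    (K₀ K₁ : U →ₗ[k] V) (M₀ M₁ : V →ₗ[k] W)
    (hcomplex : ∀ s : k, (M₀ + s • M₁) ∘ₗ (K₀ + s • K₁) = 0)
    (hexact : ker M₀ ≤ range K₀) :
    finrank k (range M₁) ≤ finrank k (range M₀) := by
  have h1 := finite_setOf_finrank_range_add_smul_lt K₀ K₁
  have h2 := (finite_setOf_finrank_range_add_smul_lt M₁ M₀).image fun s ↦ s⁻¹
  obtain ⟨s, hs⟩ := ((h1.union h2).union (Set.finite_singleton 0)).infinite_compl.nonempty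
  simp only [Set.mem_compl_iff, Set.mem_union, Set.mem_ofPred_eq, not_or, not_lt,
    Set.mem_singleton_iff] at hs
  obtain ⟨⟨hK, hM⟩, hs0⟩ := hs
  have hM : finrank k (range M₁) ≤ finrank k (range (M₁ + s⁻¹ • M₀)) := by
    by_contra! h
    exact hM ⟨s⁻¹, h, inv_inv s⟩
  have hr : range (M₁ + s⁻¹ • M₀) = range (M₀ + s • M₁) := by
    rw [← range_smul (M₁ + s⁻¹ • M₀) s hs0, smul_add, smul_smul, mul_inv_cancel₀ hs0, one_smul,
      add_comm]
  have h3 := finrank_range_add_finrank_ker (M₀ + s • M₁)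
  have h4 := finrank_range_add_finrank_ker M₀
  have h5 : finrank k (range (K₀ + s • K₁)) ≤ finrank k (ker (M₀ + s • M₁)) :=
    Submodule.finrank_mono (range_le_ker_iff.mpr (hcomplex s))
  have h6 := Submodule.finrank_mono hexact
  rw [hr] at hM
  omega

/-- The map `a ↦ ∑ i, a i * f i` on coefficient vectors, with range the ideal of the `f i`. It is only
recorded as a `k`-linear map. -/
def combination (k : Type*) {T ι : Type*} [Field k] [CommRing T] [Algebra k T] [Fintype ι]
    (f : ι → T) : (ι → T) →ₗ[k] T where
  toFun a := ∑ i, a i * f i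
  map_add' a b := by simp [add_mul, Finset.sum_add_distrib]
  map_smul' c a := by simp [Finset.smul_sum]

/-- The Koszul relations among the `f i`, as combinations of the standard ones. All families `u` are
allowed and antisymmetrized inside the map. -/
def koszul (k : Type*) {T ι : Type*} [Field k] [CommRing T] [Algebra k T] [Fintype ι]
    (f : ι → T) : (ι → ι → T) →ₗ[k] (ι → T) where
  toFun u i := ∑ j, (u i j - u j i) * f j
  map_add' u v := by
    ext i
    simp only [Pi.add_apply, ← Finset.sum_add_distrib]
    exact Finset.sum_congr rfl fun j _ ↦ by ring
  map_smul' c u := by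
    ext i
    simp [Finset.smul_sum, ← smul_sub]

section
variable {k T ι : Type*} [Field k] [CommRing T] [Algebra k T] [Fintype ι]

theorem combination_apply (f a : ι → T) : combination k f a = ∑ i, a i * f i := rfl

theorem koszul_apply (f : ι → T) (u : ι → ι → T) (i : ι) :
    koszul k f u i = ∑ j, (u i j - u j i) * f j := rfl

theorem combination_koszul (f : ι → T) (u : ι → ι → T) : combination k f (koszul k f u) = 0 := by
  simp only [combination_apply, koszul_apply, sub_mul, Finset.sum_sub_distrib, Finset.sum_mul]
  rw [sub_eq_zero, Finset.sum_comm]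
  exact Finset.sum_congr rfl fun i _ ↦ Finset.sum_congr rfl fun j _ ↦ by ring

theorem range_combination (f : ι → T) :
    LinearMap.range (combination k f) = (Ideal.span (Set.range f)).restrictScalars k := by
  ext x
  simp [Ideal.mem_span_range_iff_exists_fun, combination_apply]

theorem combination_add_smul (f g : ι → T) (s : k) :
    combination k g + s • combination k f = combination k (g + s • f) := by
  ext a
  simp [combination_apply, mul_add, Finset.sum_add_distrib, Finset.smul_sum]

theorem koszul_add_smul (f g : ι → T) (s : k) :
    koszul k g + s • koszul k f = koszul k (g + s • f) := by
  ext a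
  simp [koszul_apply, mul_add, Finset.sum_add_distrib, Finset.smul_sum]

/-- If all syzygies of `g` are Koszul modulo an ideal `J` that kills all the `f i` and `g i`, then `g`
spans an ideal at least as large as that of `f`: the relations of `g` deform to relations of
`g + s f`, which therefore has no fewer of them for general `s`. -/
theorem finrank_quotient_span_le_of_koszul [Infinite k] [FiniteDimensional k T]
    (J : Ideal T) (f g : ι → T) (hf : ∀ i, ∀ a ∈ J, a * f i = 0) (hg : ∀ i, ∀ a ∈ J, a * g i = 0)
    (hsyz : ∀ a : ι → T, ∑ i, a i * g i = 0 →
      ∃ u : ι → ι → T, ∀ i, a i - ∑ j, (u i j - u j i) * g j ∈ J) :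
    finrank k (T ⧸ Ideal.span (Set.range g)) ≤ finrank k (T ⧸ Ideal.span (Set.range f)) := by
  let J' : Submodule k (ι → T) := Submodule.pi Set.univ fun _ ↦ J.restrictScalars k
  have key := LinearMap.finrank_range_le_of_pencil_complex
    ((koszul k g).coprod J'.subtype) ((koszul k f).coprod 0) (combination k g) (combination k f)
    (fun s ↦ by
      refine LinearMap.ext fun ⟨u, v⟩ ↦ ?_
      have h1 : ∀ i, v.1 i * g i = 0 := fun i ↦ hg i _ (v.2 i trivial)
      have h2 : ∀ i, v.1 i * f i = 0 := fun i ↦ hf i _ (v.2 i trivial)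
      have h3 : ((koszul k g).coprod J'.subtype + s • (koszul k f).coprod 0 :
          ((ι → ι → T) × J') →ₗ[k] (ι → T)) (u, v) =
          koszul k (g + s • f) u + v.1 := by
        rw [← koszul_add_smul]
        simp [add_right_comm]
      rw [combination_add_smul, LinearMap.comp_apply, h3, map_add, combination_koszul]
      simp [combination_apply, mul_add, h1, h2])
    (fun a ha ↦ by
      obtain ⟨u, hu⟩ := hsyz a ha
      exact ⟨(u, ⟨a - koszul k g u, fun i _ ↦ hu i⟩), by simp⟩)
  rw [range_combination, range_combination] at key
  have h1 := (Ideal.span (Set.range f)).restrictScalars k |>.finrank_quotient_add_finrank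
  have h2 := (Ideal.span (Set.range g)).restrictScalars k |>.finrank_quotient_add_finrank
  change finrank k (T ⧸ Ideal.span (Set.range f)) + _ = _ at h1
  change finrank k (T ⧸ Ideal.span (Set.range g)) + _ = _ at h2
  omega
end

end

/-! ### The Boolean lattice -/

noncomputable section

open Module

/-- The raising operator of the Boolean lattice: `(U φ) T = ∑ i ∈ T, φ (T \ {i})`. -/
def booleanUp (k σ : Type*) [Field k] [DecidableEq σ] : End k (Finset σ → k) where
  toFun φ T := ∑ i ∈ T, φ (T.erase i)
  map_add' _ _ := by ext; simp [Finset.sum_add_distrib]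
  map_smul' _ _ := by ext; simp [Finset.mul_sum]

/-- The lowering operator of the Boolean lattice: `(D φ) T = ∑ i ∉ T, φ (T ∪ {i})`. -/
def booleanDown (k σ : Type*) [Field k] [Fintype σ] [DecidableEq σ] : End k (Finset σ → k) where
  toFun φ T := ∑ i ∈ Tᶜ, φ (insert i T)
  map_add' _ _ := by ext; simp [Finset.sum_add_distrib]
  map_smul' _ _ := by ext; simp [Finset.mul_sum]

section
variable {k σ : Type*} [Field k] [DecidableEq σ]

theorem booleanUp_apply (φ : Finset σ → k) (T : Finset σ) :
    booleanUp k σ φ T = ∑ i ∈ T, φ (T.erase i) := rfl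

theorem booleanUp_booleanUp_pow (s : ℕ) (φ : Finset σ → k) :
    booleanUp k σ ((booleanUp k σ ^ s) φ) = (booleanUp k σ ^ (s + 1)) φ := by
  rw [pow_succ', Module.End.mul_apply]

theorem booleanUp_pow_apply_eq_zero {φ : Finset σ → k} {p : ℕ → Prop}
    (hφ : ∀ T : Finset σ, p T.card → φ T = 0) (s : ℕ) (T : Finset σ)
    (hT : ∀ e, T.card = e + s → p e) : (booleanUp k σ ^ s) φ T = 0 := by
  induction s generalizing T with
  | zero => exact hφ T (hT _ rfl)
  | succ s ih =>
    rw [pow_succ', Module.End.mul_apply, booleanUp_apply]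
    refine Finset.sum_eq_zero fun i hi ↦ ih _ fun e he ↦ hT e ?_
    rw [Finset.card_erase_of_mem hi] at he
    have := Finset.card_pos.mpr ⟨i, hi⟩
    omega

variable [Fintype σ]

theorem booleanDown_apply (φ : Finset σ → k) (T : Finset σ) :
    booleanDown k σ φ T = ∑ i ∈ Tᶜ, φ (insert i T) := rfl

/-- On level `e` of the Boolean lattice, the commutator `D U - U D` is the scalar `|σ| - 2 e`. -/
theorem booleanDown_booleanUp_apply (φ : Finset σ → k) (T : Finset σ) :
    booleanDown k σ (booleanUp k σ φ) T =
      booleanUp k σ (booleanDown k σ φ) T + (Fintype.card σ - 2 * T.card) * φ T := by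
  have h1 : booleanDown k σ (booleanUp k σ φ) T =
      Tᶜ.card * φ T + ∑ i ∈ Tᶜ, ∑ j ∈ T, φ (insert i (T.erase j)) := by
    rw [booleanDown_apply, ← nsmul_eq_mul, ← Finset.sum_const, ← Finset.sum_add_distrib]
    refine Finset.sum_congr rfl fun i hi ↦ ?_
    have hi' : i ∉ T := by simpa using hi
    rw [booleanUp_apply, Finset.sum_insert hi', Finset.erase_insert hi']
    congr 1
    refine Finset.sum_congr rfl fun j hj ↦ ?_
    rw [Finset.erase_insert_of_ne]
    rintro rfl
    exact hi' hj
  have h2 : booleanUp k σ (booleanDown k σ φ) T =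
      T.card * φ T + ∑ i ∈ Tᶜ, ∑ j ∈ T, φ (insert i (T.erase j)) := by
    rw [Finset.sum_comm, booleanUp_apply, ← nsmul_eq_mul, ← Finset.sum_const,
      ← Finset.sum_add_distrib]
    refine Finset.sum_congr rfl fun j hj ↦ ?_
    rw [booleanDown_apply, Finset.compl_erase, Finset.sum_insert (by simpa using hj),
      Finset.insert_erase hj]
  rw [h1, h2, Finset.card_compl, Nat.cast_sub (Finset.card_le_univ T)]
  ring

theorem booleanDown_booleanUp_pow {φ : Finset σ → k} {e : ℕ} (hφ : ∀ T, T.card ≠ e → φ T = 0)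
    (s : ℕ) :
    booleanDown k σ ((booleanUp k σ ^ (s + 1)) φ) =
      (booleanUp k σ ^ (s + 1)) (booleanDown k σ φ) +
        ((s + 1) * (Fintype.card σ - 2 * e - s) : k) • (booleanUp k σ ^ s) φ := by
  have hU (s : ℕ) : booleanDown k σ ((booleanUp k σ ^ (s + 1)) φ) =
      booleanUp k σ (booleanDown k σ ((booleanUp k σ ^ s) φ)) +
        (Fintype.card σ - 2 * (e + s) : k) • (booleanUp k σ ^ s) φ := by
    ext T
    rw [pow_succ', Module.End.mul_apply, booleanDown_booleanUp_apply, Pi.add_apply, Pi.smul_apply,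
      smul_eq_mul]
    by_cases hT : T.card = e + s
    · rw [hT]; push_cast; rfl
    · rw [booleanUp_pow_apply_eq_zero (p := (· ≠ e)) hφ s T (by omega)]; simp
  induction s with
  | zero => rw [hU]; simp
  | succ s ih =>
    rw [hU, ih, map_add, map_smul, booleanUp_booleanUp_pow, booleanUp_booleanUp_pow, add_assoc,
      ← add_smul]
    congr 2
    push_cast
    ring

/-- The injective half of the strong Lefschetz property of the Boolean lattice: `U ^ s` is injective
on level `e` if level `e + s` is no further from the middle. If `U ^ (s + 1)` kills `φ`, then
`U ^ (s + 2)` kills `D φ`, which lies one level lower and so vanishes; the commutation relation then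
shows that `U ^ s` kills `φ`. -/
theorem eq_zero_of_booleanUp_pow_eq_zero [CharZero k] {e s : ℕ} (h : 2 * e + s ≤ Fintype.card σ)
    {φ : Finset σ → k} (hφ : ∀ T, T.card ≠ e → φ T = 0) (hs : (booleanUp k σ ^ s) φ = 0) :
    φ = 0 := by
  induction e using Nat.strong_induction_on generalizing s φ with
  | _ e ihe =>
    induction s with
    | zero => exact hs
    | succ s ih =>
      refine ih (by omega) ?_
      have hc := booleanDown_booleanUp_pow hφ s
      have hD : booleanDown k σ φ = 0 := by
        rcases e with _ | e
        · ext T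
          exact Finset.sum_eq_zero fun i _ ↦ hφ _ (Finset.card_pos.mpr ⟨i, by simp⟩).ne'
        refine ihe e e.lt_succ_self (s := s + 2) (by omega) (fun T hT ↦ ?_) ?_
        · refine Finset.sum_eq_zero fun i hi ↦ hφ _ ?_
          rw [Finset.card_insert_of_notMem (by simpa using hi)]
          omega
        · have := congr(booleanUp k σ $hc)
          rwa [hs, map_zero, map_zero, map_add, map_smul, booleanUp_booleanUp_pow,
            booleanUp_booleanUp_pow, hs, smul_zero, add_zero, eq_comm] at this
      rw [hs, map_zero, hD, map_zero, zero_add, eq_comm, smul_eq_zero] at hc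
      refine hc.resolve_left (mul_ne_zero (Nat.cast_add_one_ne_zero s) ?_)
      rw [sub_sub, sub_ne_zero]
      norm_cast
      omega

/-- The injectivity of `U ^ s` on functions spread over the levels below `n`, which `U ^ s` maps to
distinct levels. -/
theorem eq_zero_of_booleanUp_pow_eq_zero_of_lt [CharZero k] {n s : ℕ}
    (h : ∀ e < n, 2 * e + s ≤ Fintype.card σ)
    {φ : Finset σ → k} (hφ : ∀ T : Finset σ, n ≤ T.card → φ T = 0)
    (hs : (booleanUp k σ ^ s) φ = 0) :
    φ = 0 := by
  ext S
  by_cases hS : n ≤ S.card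
  · exact hφ S hS
  push Not at hS
  let ψ : Finset σ → k := fun T ↦ if T.card = S.card then φ T else 0
  suffices ψ = 0 by simpa [ψ] using congr_fun this S
  refine eq_zero_of_booleanUp_pow_eq_zero (h _ hS) (fun T hT ↦ if_neg hT) ?_
  ext T
  by_cases hT : T.card = S.card + s
  · have h1 := booleanUp_pow_apply_eq_zero (φ := φ - ψ) (p := fun e ↦ e = S.card)
      (fun T hT ↦ by simp [ψ, hT]) s T (by omega)
    rw [map_sub, hs] at h1
    simpa using h1
  · exact booleanUp_pow_apply_eq_zero (p := fun e ↦ e ≠ S.card) (fun T hT ↦ if_neg hT) s T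
      (by omega)

theorem card_finset_card_lt (σ : Type*) [Fintype σ] [DecidableEq σ] (n : ℕ) :
    Fintype.card {T : Finset σ // T.card < n} =
      ∑ i ∈ Finset.range n, (Fintype.card σ).choose i := by
  rw [Fintype.card_subtype]
  induction n with
  | zero => simp
  | succ n ih =>
    rw [Finset.sum_range_succ, ← ih, ← Finset.card_univ, ← Finset.card_powersetCard,
      ← Finset.card_union_of_disjoint]
    · congr 1
      ext T
      simp
      omega
    · rw [Finset.disjoint_left]
      intro T
      simp
      omega
end

end

/-! ### The squares of the variables and of their sum -/

noncomputable section

open Module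

section
variable {T ι : Type*} [CommRing T] [DecidableEq ι]

/-- A syzygy of `f` over `insert i₀ S` is Koszul as soon as its coefficient at `i₀` lies in the ideal
of the `f i`, `i ∈ S`, and all syzygies over `S` are Koszul. -/
theorem exists_koszul_insert {f : ι → T} {S : Finset ι} {i₀ : ι} (hi₀ : i₀ ∉ S)
    (hS : ∀ c : ι → T, ∑ i ∈ S, c i * f i = 0 →
      ∃ u : ι → ι → T, ∀ i ∈ S, c i = ∑ j ∈ S, (u i j - u j i) * f j)
    {c : ι → T} (hc : ∑ i ∈ insert i₀ S, c i * f i = 0) (hc₀ : c i₀ ∈ Ideal.span (f '' S)) :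
    ∃ u : ι → ι → T, ∀ i ∈ insert i₀ S, c i = ∑ j ∈ insert i₀ S, (u i j - u j i) * f j := by
  obtain ⟨b, hb⟩ : ∃ b : ι → T, ∑ j ∈ S, b j * f j = c i₀ := by
    obtain ⟨b, hb⟩ := (Submodule.mem_span_image_finset_iff_exists_fun T).mp hc₀
    refine ⟨fun j ↦ if h : j ∈ S then b ⟨j, h⟩ else 0, ?_⟩
    rw [← Finset.sum_coe_sort, ← hb]
    simp
  rw [Finset.sum_insert hi₀, ← hb] at hc
  obtain ⟨u, hu⟩ := hS (fun i ↦ c i + b i * f i₀) (by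
    rw [← hc, Finset.sum_mul, ← Finset.sum_add_distrib]
    exact Finset.sum_congr rfl fun i _ ↦ by ring)
  refine ⟨fun i j ↦ if i = i₀ then b j else if j = i₀ then 0 else u i j, fun i hi ↦ ?_⟩
  have hne : ∀ j ∈ S, j ≠ i₀ := fun j hj h ↦ hi₀ (h ▸ hj)
  rw [Finset.sum_insert hi₀]
  rcases Finset.mem_insert.mp hi with rfl | hi
  · rw [← hb, sub_self, zero_mul, zero_add]
    exact Finset.sum_congr rfl fun j hj ↦ by simp [hne j hj]
  · have h1 := hu i hi
    have h2 : ∑ j ∈ S, ((if i = i₀ then b j else if j = i₀ then 0 else u i j) -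
        (if j = i₀ then b i else if i = i₀ then 0 else u j i)) * f j =
        ∑ j ∈ S, (u i j - u j i) * f j :=
      Finset.sum_congr rfl fun j hj ↦ by simp [hne j hj, hne i hi]
    rw [h2, ← h1]
    simp [hne i hi]

end

namespace MvPolynomial

variable (k : Type*) {σ : Type*} [Field k]

/-- The exponent of the squarefree monomial with the given set of variables. -/
def sqfreeExponent (T : Finset σ) : σ →₀ ℕ := ∑ i ∈ T, Finsupp.single i 1

theorem degree_sqfreeExponent (T : Finset σ) : (sqfreeExponent T).degree = T.card := by
  simp [sqfreeExponent]

section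

/-- The coefficients of a polynomial at the squarefree monomials. -/
def sqfreeCoeff : MvPolynomial σ k →ₗ[k] (Finset σ → k) :=
  LinearMap.pi fun T ↦ lcoeff k (sqfreeExponent T)

variable {k}

theorem sqfreeCoeff_apply (a : MvPolynomial σ k) (T : Finset σ) :
    sqfreeCoeff k a T = a.coeff (sqfreeExponent T) := rfl

theorem sqfreeCoeff_eq_zero_of_mem {a : MvPolynomial σ k} {n : ℕ} (ha : a ∈ idealOfVars σ k ^ n)
    {T : Finset σ} (hT : T.card < n) : sqfreeCoeff k a T = 0 :=
  (mem_pow_idealOfVars_iff' _ _).mp ha _ (by rwa [degree_sqfreeExponent])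

variable [DecidableEq σ]

theorem sqfreeExponent_apply (T : Finset σ) (i : σ) :
    sqfreeExponent T i = if i ∈ T then 1 else 0 := by
  simp [sqfreeExponent, Finsupp.finsetSum_apply, Finsupp.single_apply]

theorem sqfreeExponent_injective : Function.Injective (sqfreeExponent (σ := σ)) := by
  intro S T h
  ext i
  have := DFunLike.congr_fun h i
  rw [sqfreeExponent_apply, sqfreeExponent_apply] at this
  by_cases h1 : i ∈ S <;> by_cases h2 : i ∈ T <;> simp_all

theorem sqfreeCoeff_X_mul (i : σ) (a : MvPolynomial σ k) (T : Finset σ) :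
    sqfreeCoeff k (X i * a) T = if i ∈ T then sqfreeCoeff k a (T.erase i) else 0 := by
  have h : i ∈ (sqfreeExponent T).support ↔ i ∈ T := by
    rw [Finsupp.mem_support_iff, sqfreeExponent_apply]
    simp
  rw [sqfreeCoeff_apply, coeff_X_mul']
  by_cases hi : i ∈ T
  · rw [if_pos (h.mpr hi), if_pos hi, sqfreeCoeff_apply]
    congr 1
    rw [sqfreeExponent, ← Finset.sum_erase_add _ _ hi, add_tsub_cancel_right, sqfreeExponent]
  · rw [if_neg (h.not.mpr hi), if_neg hi]

theorem sqfreeCoeff_eq_zero_iff {a : MvPolynomial σ k} :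
    sqfreeCoeff k a = 0 ↔ a ∈ Ideal.span (Set.range fun i : σ ↦ X i ^ 2) := by
  have h : (Set.range fun i : σ ↦ (X i ^ 2 : MvPolynomial σ k)) =
      (fun s ↦ monomial s 1) '' (Set.range fun i : σ ↦ Finsupp.single i 2) := by
    rw [← Set.range_comp]
    congr 1
    ext i
    simp [X_pow_eq_monomial]
  rw [h, mem_ideal_span_monomial_image]
  constructor
  · intro ha m hm
    by_contra! hcon
    have hm1 : ∀ i, m i ≤ 1 := fun i ↦ by
      have := hcon _ ⟨i, rfl⟩
      rw [Finsupp.single_le_iff] at this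
      omega
    have hm2 : m = sqfreeExponent m.support := by
      ext i
      rw [sqfreeExponent_apply]
      have := hm1 i
      split_ifs with h <;> rw [Finsupp.mem_support_iff] at h <;> omega
    have := congr_fun ha m.support
    rw [sqfreeCoeff_apply, ← hm2] at this
    exact mem_support_iff.mp hm this
  · intro ha
    ext T
    by_contra hT
    obtain ⟨_, ⟨i, rfl⟩, hi⟩ := ha _ (mem_support_iff.mpr hT)
    rw [Finsupp.single_le_iff, sqfreeExponent_apply] at hi
    split_ifs at hi <;> omega

theorem sqfreeCoeff_surjective [Fintype σ] : Function.Surjective (sqfreeCoeff (σ := σ) k) := by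
  intro φ
  refine ⟨∑ T, monomial (sqfreeExponent T) (φ T), ?_⟩
  ext S
  simp [sqfreeCoeff_apply, coeff_sum, coeff_monomial, sqfreeExponent_injective.eq_iff]

theorem sqfreeCoeff_sum_X_mul [Fintype σ] (a : MvPolynomial σ k) :
    sqfreeCoeff k ((∑ i, X i) * a) = booleanUp k σ (sqfreeCoeff k a) := by
  ext T
  rw [Finset.sum_mul, map_sum, Finset.sum_apply, booleanUp_apply]
  simp [sqfreeCoeff_X_mul]

theorem sqfreeCoeff_sum_X_sq_mul [Fintype σ] (a : MvPolynomial σ k) :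
    sqfreeCoeff k ((∑ i, X i) ^ 2 * a) = (booleanUp k σ ^ 2) (sqfreeCoeff k a) := by
  rw [pow_two, mul_assoc, sqfreeCoeff_sum_X_mul, sqfreeCoeff_sum_X_mul, pow_two,
    Module.End.mul_apply]

end

variable (σ) in
/-- The quadrics `x_i ^ 2` and `(∑ x_i) ^ 2`. -/
def squares [Fintype σ] : Option σ → MvPolynomial σ k
  | none => (∑ i, X i) ^ 2
  | some i => X i ^ 2

variable [Fintype σ]

theorem isHomogeneous_squares (i : Option σ) : (squares k σ i).IsHomogeneous 2 := by
  cases i with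
  | none => exact (IsHomogeneous.sum _ _ _ fun i _ ↦ isHomogeneous_X k i).pow 2
  | some i => exact (isHomogeneous_X k i).pow 2

theorem squares_mem (i : Option σ) : squares k σ i ∈ idealOfVars σ k ^ 2 := by
  rw [mem_pow_idealOfVars_iff']
  exact fun x hx ↦ (isHomogeneous_squares k i).coeff_eq_zero hx.ne

variable {k}

theorem mem_span_squares_of_mul_mem {S : Finset (Option σ)} (hS : none ∉ S) {i : σ} (hi : some i ∉ S)
    {a : MvPolynomial σ k} (ha : a * X i ^ 2 ∈ Ideal.span (squares k σ '' S)) :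
    a ∈ Ideal.span (squares k σ '' S) := by
  have h : squares k σ '' S = (fun s ↦ monomial s 1) ''
      ((fun i : σ ↦ Finsupp.single i 2) '' {i | some i ∈ S}) := by
    rw [Set.image_image]
    ext x
    simp only [Set.mem_image, Finset.mem_coe, Option.exists, hS, false_and, false_or]
    simp [squares, X_pow_eq_monomial]
  rw [h, mem_ideal_span_monomial_image] at ha ⊢
  intro m hm
  obtain ⟨_, ⟨j, hj, rfl⟩, hle⟩ := ha (m + Finsupp.single i 2) (by
    rw [mem_support_iff, X_pow_eq_monomial, coeff_mul_monomial]
    simpa using hm)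
  refine ⟨_, ⟨j, hj, rfl⟩, ?_⟩
  rw [Finsupp.single_le_iff] at hle ⊢
  have hij : i ≠ j := fun h ↦ hi (h ▸ hj)
  simpa [Finsupp.single_apply, hij] using hle

variable [DecidableEq σ]

/-- The monomials `x_i ^ 2` form a regular sequence, so their syzygies are Koszul. -/
theorem exists_koszul_squares_of_none_notMem (S : Finset (Option σ)) (hS : none ∉ S)
    (c : Option σ → MvPolynomial σ k) (hc : ∑ i ∈ S, c i * squares k σ i = 0) :
    ∃ u : Option σ → Option σ → MvPolynomial σ k,
      ∀ i ∈ S, c i = ∑ j ∈ S, (u i j - u j i) * squares k σ j := by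
  induction S using Finset.induction_on generalizing c with
  | empty => exact ⟨0, by simp⟩
  | insert i S hi ih =>
    have hS' : none ∉ S := fun h ↦ hS (Finset.mem_insert_of_mem h)
    refine exists_koszul_insert hi (ih hS') hc ?_
    cases i with
    | none => exact absurd (Finset.mem_insert_self _ _) hS
    | some i =>
      refine mem_span_squares_of_mul_mem hS' hi ?_
      rw [Finset.sum_insert hi] at hc
      rw [show X i ^ 2 = squares k σ (some i) from rfl, eq_neg_of_add_eq_zero_left hc]
      exact neg_mem (sum_mem fun j hj ↦ Ideal.mul_mem_left _ _ (Ideal.subset_span ⟨j, hj, rfl⟩))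

/-- Multiplication by `(∑ x_i) ^ 2` on `k[x] / (x_i ^ 2)` is injective in degrees below `|σ| / 2`: in
the basis of squarefree monomials, multiplication by `∑ x_i` is the raising operator. -/
theorem mem_span_sq_of_sum_sq_mul_mem [CharZero k] {n : ℕ} (hn : 2 * n ≤ Fintype.card σ)
    {a : MvPolynomial σ k} (ha : ∀ m, n ≤ m.degree → a.coeff m = 0)
    (h : a * (∑ i, X i) ^ 2 ∈ Ideal.span (Set.range fun i : σ ↦ (X i ^ 2 : MvPolynomial σ k))) :
    a ∈ Ideal.span (Set.range fun i : σ ↦ (X i ^ 2 : MvPolynomial σ k)) := by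
  rw [← sqfreeCoeff_eq_zero_iff] at h ⊢
  refine eq_zero_of_booleanUp_pow_eq_zero_of_lt (n := n) (s := 2) (fun e he ↦ by omega)
    (fun T hT ↦ ha _ (by rwa [degree_sqfreeExponent])) ?_
  rw [← h, mul_comm, sqfreeCoeff_sum_X_sq_mul]

/-- The relations among the quadrics `x_i ^ 2` and `(∑ x_i) ^ 2` are Koszul as long as the coefficient
of `(∑ x_i) ^ 2` has degree below the middle. -/
theorem exists_koszul_squares [CharZero k] {n : ℕ} (hn : 2 * n ≤ Fintype.card σ)
    {c : Option σ → MvPolynomial σ k} (hc0 : ∀ m, n ≤ m.degree → (c none).coeff m = 0)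
    (hc : ∑ i, c i * squares k σ i = 0) :
    ∃ u : Option σ → Option σ → MvPolynomial σ k,
      ∀ i, c i = ∑ j, (u i j - u j i) * squares k σ j := by
  have huniv : insert none (Finset.univ.erase none) = (Finset.univ : Finset (Option σ)) :=
    Finset.insert_erase (Finset.mem_univ _)
  have hspan : squares k σ '' (Finset.univ.erase none : Finset (Option σ)) =
      Set.range fun i : σ ↦ (X i ^ 2 : MvPolynomial σ k) := by
    ext x
    simp [squares, Option.exists]
  have hnot : none ∉ (Finset.univ.erase none : Finset (Option σ)) := by simp
  obtain ⟨u, hu⟩ := exists_koszul_insert (f := squares k σ) (c := c) hnot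
    (exists_koszul_squares_of_none_notMem _ hnot) (by rwa [huniv]) (by
      rw [hspan]
      refine mem_span_sq_of_sum_sq_mul_mem hn hc0 ?_
      rw [← huniv, Finset.sum_insert hnot] at hc
      rw [show (∑ i, X i) ^ 2 = squares k σ none from rfl, eq_neg_of_add_eq_zero_left hc, ← hspan]
      exact neg_mem (sum_mem fun j hj ↦ Ideal.mul_mem_left _ _ (Ideal.subset_span ⟨j, hj, rfl⟩)))
  rw [huniv] at hu
  exact ⟨u, fun i ↦ hu i (Finset.mem_univ i)⟩

end MvPolynomial

end

/-! ### Ideals of elements of order two in truncated polynomial rings -/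

noncomputable section

open Module

namespace MvPolynomial

section
variable {k σ : Type*} [Field k]

theorem finite_quotient_idealOfVars_pow [Finite σ] (n : ℕ) :
    FiniteDimensional k (MvPolynomial σ k ⧸ idealOfVars σ k ^ n) := by
  let S : Submodule k (MvPolynomial σ k) := restrictTotalDegree σ k n
  have : FiniteDimensional k S := by
    infer_instance
  refine Module.Finite.of_surjective
    ((Ideal.Quotient.mkₐ k (idealOfVars σ k ^ n)).toLinearMap ∘ₗ S.subtype) fun x ↦ ?_
  obtain ⟨p, rfl⟩ := Ideal.Quotient.mk_surjective x
  refine ⟨⟨∑ e ∈ Finset.range n, homogeneousComponent e p, ?_⟩, ?_⟩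
  · refine sum_mem fun e he ↦ ?_
    rw [mem_restrictTotalDegree]
    exact (homogeneousComponent_isHomogeneous e p).totalDegree_le.trans (Finset.mem_range.mp he).le
  · refine Ideal.Quotient.eq.mpr ((mem_pow_idealOfVars_iff' _ _).mpr fun m hm ↦ ?_)
    simp [coeff_sum, coeff_homogeneousComponent, hm]

end

section
variable {k σ : Type*} [Field k] [Fintype σ] [DecidableEq σ]

open Classical in
/-- Modulo the `x_i ^ 2`, the squarefree monomials of degree at most `t` form a basis of the truncated
polynomial ring, and the multiples of `(∑ x_i) ^ 2` are spanned by as many elements as there are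
squarefree monomials of degree at most `t - 2`. What remains are two levels of binomial coefficients,
`|σ|` over `t - 1` and `|σ|` over `t`. -/
theorem choose_le_finrank_quotient_squares (t : ℕ) :
    (Fintype.card σ + 1).choose t ≤ finrank k ((MvPolynomial σ k ⧸ idealOfVars σ k ^ (t + 1)) ⧸
      Ideal.span (Set.range fun i ↦ Ideal.Quotient.mk (idealOfVars σ k ^ (t + 1))
        (squares k σ i))) := by
  set T := MvPolynomial σ k ⧸ idealOfVars σ k ^ (t + 1)
  set I := Ideal.span (Set.range fun i ↦ Ideal.Quotient.mk (idealOfVars σ k ^ (t + 1))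
        (squares k σ i))
  have := finite_quotient_idealOfVars_pow (k := k) (σ := σ) (t + 1)
  let ext (p : Finset σ → Prop) : ({S // p S} → k) →ₗ[k] (Finset σ → k) :=
    Function.ExtendByZero.linearMap k Subtype.val
  have hext (p : Finset σ → Prop) (φ : Finset σ → k) (hφ : ∀ S, ¬ p S → φ S = 0) :
      ext p (fun S ↦ φ S) = φ := by
    ext S
    by_cases hS : p S
    · exact Subtype.val_injective.extend_apply (fun S : {S // p S} ↦ φ S) 0 ⟨S, hS⟩
    · rw [hφ S hS]
      refine Function.extend_apply' (fun S : {S // p S} ↦ φ S) (0 : Finset σ → k) S ?_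
      rintro ⟨S', rfl⟩
      exact hS S'.2
  -- `N` collects the multiples of `(∑ x_i) ^ 2` and the monomials of degree above `t`; the square
  -- carries degree at least `t - 1` beyond degree `t`, so only smaller degrees are multiplied
  let N : Submodule k (Finset σ → k) :=
    LinearMap.range (((booleanUp k σ ^ 2) ∘ₗ ext fun S ↦ S.card < t - 1).coprod
      (ext fun S ↦ ¬ S.card < t + 1))
  have hN1 (φ : Finset σ → k) (hφ : ∀ S : Finset σ, S.card < t + 1 → φ S = 0) : φ ∈ N :=
    ⟨(0, fun S ↦ φ S), by simpa using hext (fun S ↦ ¬ S.card < t + 1) φ (by simpa using hφ)⟩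
  have hN2 (φ : Finset σ → k) : (booleanUp k σ ^ 2) φ ∈ N := by
    let φ₀ : Finset σ → k := fun S ↦ if S.card < t - 1 then φ S else 0
    rw [← add_sub_cancel φ₀ φ, map_add]
    refine add_mem ⟨(fun S ↦ φ₀ S, 0), ?_⟩ (hN1 _ fun S hS ↦ ?_)
    · simp [hext (fun S ↦ S.card < t - 1) φ₀ fun S hS ↦ if_neg hS]
    · refine booleanUp_pow_apply_eq_zero (p := fun e ↦ e < t - 1) (fun S hS ↦ ?_) 2 S (by omega)
      simp [φ₀, hS]
  let Φ : MvPolynomial σ k →ₗ[k] (Finset σ → k) ⧸ N := N.mkQ ∘ₗ sqfreeCoeff k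
  have hΦ : Function.Surjective Φ := (N.mkQ_surjective).comp sqfreeCoeff_surjective
  let π : MvPolynomial σ k →ₗ[k] T ⧸ I :=
    ((Ideal.Quotient.mkₐ k I).comp (Ideal.Quotient.mkₐ k (idealOfVars σ k ^ (t + 1)))).toLinearMap
  have hπ : Function.Surjective π := Ideal.Quotient.mk_surjective.comp Ideal.Quotient.mk_surjective
  have hker : LinearMap.ker π ≤ LinearMap.ker Φ := by
    intro a ha
    have ha' : Ideal.Quotient.mk (idealOfVars σ k ^ (t + 1)) a ∈ I :=
      Ideal.Quotient.eq_zero_iff_mem.mp ha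
    obtain ⟨b, hb⟩ := Ideal.mem_span_range_iff_exists_fun.mp ha'
    choose c hc using fun i ↦ Ideal.Quotient.mk_surjective (b i)
    have hmem : a - ∑ i, squares k σ i * c i ∈ idealOfVars σ k ^ (t + 1) := by
      rw [← Ideal.Quotient.eq, ← hb, map_sum]
      simp [hc, mul_comm]
    rw [LinearMap.mem_ker]
    refine (Submodule.Quotient.mk_eq_zero N).mpr ?_
    rw [← sub_add_cancel a (∑ i, squares k σ i * c i), map_add, map_sum]
    refine add_mem (hN1 _ fun S hS ↦ sqfreeCoeff_eq_zero_of_mem hmem hS) (sum_mem fun i _ ↦ ?_)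
    cases i with
    | none =>
      rw [squares, sqfreeCoeff_sum_X_sq_mul]
      exact hN2 _
    | some i =>
      rw [sqfreeCoeff_eq_zero_iff.mpr]
      · exact zero_mem _
      · exact Ideal.mul_mem_right _ _ (Ideal.subset_span ⟨i, rfl⟩)
  have h1 : finrank k ((Finset σ → k) ⧸ N) ≤ finrank k (T ⧸ I) := by
    refine LinearMap.finrank_le_finrank_of_surjective (f := ((LinearMap.ker π).liftQ Φ hker) ∘ₗ
      (π.quotKerEquivOfSurjective hπ).symm.toLinearMap) ?_
    intro x
    obtain ⟨a, rfl⟩ := hΦ x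
    exact ⟨π.quotKerEquivOfSurjective hπ (Submodule.Quotient.mk a), by simp⟩
  refine le_trans ?_ h1
  have h2 := N.finrank_quotient_add_finrank
  have h3 : finrank k N ≤ _ := LinearMap.finrank_range_le _
  rw [finrank_prod, finrank_fintype_fun_eq_card, finrank_fintype_fun_eq_card,
    Fintype.card_subtype_compl, card_finset_card_lt, card_finset_card_lt] at h3
  rw [finrank_fintype_fun_eq_card] at h2
  have h4 : ∑ i ∈ Finset.range (t + 1), (Fintype.card σ).choose i =
      (∑ i ∈ Finset.range (t - 1), (Fintype.card σ).choose i) + (Fintype.card σ + 1).choose t := by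
    rcases t with _ | t
    · simp
    · rw [Finset.sum_range_succ, Finset.sum_range_succ, Nat.choose_succ_succ, Nat.add_sub_cancel]
      ring
  have h5 := Fintype.card_subtype_le (fun S : Finset σ ↦ S.card < t + 1)
  rw [card_finset_card_lt] at h5
  omega

/-- In the ring truncated above degree `t`, the relations among the quadrics are Koszul up to the
coefficients of degree at least `t - 1`, which kill all quadrics. -/
theorem exists_koszul_squares_quotient [CharZero k] {t : ℕ} (ht : 2 * (t - 1) ≤ Fintype.card σ)
    (a : Option σ → MvPolynomial σ k ⧸ idealOfVars σ k ^ (t + 1))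
    (ha : ∑ i, a i * Ideal.Quotient.mk (idealOfVars σ k ^ (t + 1)) (squares k σ i) = 0) :
    ∃ u : Option σ → Option σ → MvPolynomial σ k ⧸ idealOfVars σ k ^ (t + 1), ∀ i,
      a i - ∑ j, (u i j - u j i) * Ideal.Quotient.mk (idealOfVars σ k ^ (t + 1)) (squares k σ j) ∈
        (idealOfVars σ k ^ (t - 1)).map (Ideal.Quotient.mk (idealOfVars σ k ^ (t + 1))) := by
  choose c hc using fun i ↦ Ideal.Quotient.mk_surjective (a i)
  -- only the part of degree `< t - 1` of the coefficients matters
  let c' (i : Option σ) : MvPolynomial σ k :=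
    ∑ e ∈ Finset.range (t - 1), homogeneousComponent e (c i)
  have hcc' (i) : c i - c' i ∈ idealOfVars σ k ^ (t - 1) := by
    refine (mem_pow_idealOfVars_iff' _ _).mpr fun m hm ↦ ?_
    simp [c', coeff_sum, coeff_homogeneousComponent, hm]
  have hmem : ∑ i, c' i * squares k σ i ∈ idealOfVars σ k ^ (t + 1) := by
    have h1 : ∑ i, c i * squares k σ i ∈ idealOfVars σ k ^ (t + 1) := by
      rw [← Ideal.Quotient.eq_zero_iff_mem, map_sum, ← ha]
      simp [hc]
    have h2 : ∑ i, (c i - c' i) * squares k σ i ∈ idealOfVars σ k ^ (t + 1) := by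
      refine sum_mem fun i _ ↦ Ideal.pow_le_pow_right (show t + 1 ≤ t - 1 + 2 by omega) ?_
      rw [pow_add]
      exact Ideal.mul_mem_mul (hcc' i) (squares_mem k i)
    simpa [sub_mul] using sub_mem h1 h2
  have hzero : ∑ i, c' i * squares k σ i = 0 := by
    ext m
    by_cases hm : m.degree < t + 1
    · exact (mem_pow_idealOfVars_iff' _ _).mp hmem m hm
    · rw [coeff_sum, coeff_zero]
      refine Finset.sum_eq_zero fun i _ ↦ ?_
      rw [Finset.sum_mul, coeff_sum]
      refine Finset.sum_eq_zero fun e he ↦ ?_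
      refine ((homogeneousComponent_isHomogeneous e (c i)).mul
        (isHomogeneous_squares k i)).coeff_eq_zero ?_
      have := Finset.mem_range.mp he
      omega
  obtain ⟨u, hu⟩ := exists_koszul_squares ht (fun m hm ↦ by
    simp [c', coeff_sum, coeff_homogeneousComponent]; omega) hzero
  refine ⟨fun i j ↦ Ideal.Quotient.mk _ (u i j), fun i ↦ ?_⟩
  have h1 := congr(Ideal.Quotient.mk (idealOfVars σ k ^ (t + 1)) $(hu i))
  simp only [map_sum, map_mul, map_sub] at h1
  rw [← hc i, ← h1, ← map_sub]
  exact Ideal.mem_map_of_mem (Ideal.Quotient.mk (idealOfVars σ k ^ (t + 1))) (hcc' i)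

/-- `|σ| + 1` elements of order at least two in a truncated polynomial ring in the variables `σ`
generate an ideal of codimension at least that of the ideal of the `x_i ^ 2` and `(∑ x_i) ^ 2`. -/
theorem choose_le_finrank_quotient [CharZero k] {t : ℕ} (ht : 2 * (t - 1) ≤ Fintype.card σ)
    (h : Option σ → MvPolynomial σ k ⧸ idealOfVars σ k ^ (t + 1))
    (hh : ∀ i, h i ∈
      (idealOfVars σ k ^ 2).map (Ideal.Quotient.mk (idealOfVars σ k ^ (t + 1)))) :
    (Fintype.card σ + 1).choose t ≤ finrank k
      ((MvPolynomial σ k ⧸ idealOfVars σ k ^ (t + 1)) ⧸ Ideal.span (Set.range h)) := by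
  have := finite_quotient_idealOfVars_pow (k := k) (σ := σ) (t + 1)
  refine (choose_le_finrank_quotient_squares (k := k) t).trans ?_
  have hJ : ∀ x ∈ (idealOfVars σ k ^ 2).map (Ideal.Quotient.mk (idealOfVars σ k ^ (t + 1))),
      ∀ a ∈ (idealOfVars σ k ^ (t - 1)).map (Ideal.Quotient.mk (idealOfVars σ k ^ (t + 1))),
      a * x = 0 := by
    intro x hx a ha
    have h1 := Ideal.mul_mem_mul ha hx
    rw [← Ideal.map_mul, ← pow_add] at h1
    have h2 := Ideal.map_mono (f := Ideal.Quotient.mk (idealOfVars σ k ^ (t + 1)))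
      (Ideal.pow_le_pow_right (I := idealOfVars σ k) (show t + 1 ≤ t - 1 + 2 by omega)) h1
    rwa [Ideal.map_quotient_self] at h2
  exact finrank_quotient_span_le_of_koszul _ h _ (fun i ↦ hJ _ (hh i))
    (fun i ↦ hJ _ (Ideal.mem_map_of_mem _ (squares_mem k i)))
    (exists_koszul_squares_quotient ht)

end
end MvPolynomial

end

/-! ### Formally smooth algebras and truncated polynomial rings -/

noncomputable section

open Module

namespace MvPolynomial

variable {k σ : Type*} [Field k]

/-- The `j`-th power of the ideal of the origin in the polynomial ring truncated at order `N`. -/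
abbrev truncIdeal (k σ : Type*) [Field k] (N j : ℕ) :
    Ideal (MvPolynomial σ k ⧸ idealOfVars σ k ^ N) :=
  (idealOfVars σ k ^ j).map (Ideal.Quotient.mk (idealOfVars σ k ^ N))

theorem mul_mem_truncIdeal {N i j l : ℕ} (h : i + j = l)
    {a b : MvPolynomial σ k ⧸ idealOfVars σ k ^ N}
    (ha : a ∈ truncIdeal k σ N i) (hb : b ∈ truncIdeal k σ N j) :
    a * b ∈ truncIdeal k σ N l := by
  rw [← h, truncIdeal, pow_add, Ideal.map_mul]
  exact Ideal.mul_mem_mul ha hb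

theorem mk_mem_truncIdeal {N j : ℕ} (hj : j ≤ N) {p : MvPolynomial σ k} :
    Ideal.Quotient.mk (idealOfVars σ k ^ N) p ∈ truncIdeal k σ N j ↔ p ∈ idealOfVars σ k ^ j := by
  rw [← Ideal.mem_comap, truncIdeal, Ideal.comap_map_mk (Ideal.pow_le_pow_right hj)]

theorem mk_mem_truncIdeal_one {N : ℕ} {p : MvPolynomial σ k} (hp : p ∈ idealOfVars σ k) :
    Ideal.Quotient.mk (idealOfVars σ k ^ N) p ∈ truncIdeal k σ N 1 :=
  Ideal.mem_map_of_mem _ (by rwa [pow_one])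

theorem truncIdeal_anti {N i j : ℕ} (h : i ≤ j) : truncIdeal k σ N j ≤ truncIdeal k σ N i :=
  Ideal.map_mono (Ideal.pow_le_pow_right h)

theorem mk_X_mem_truncIdeal (N : ℕ) (i : σ) :
    Ideal.Quotient.mk (idealOfVars σ k ^ N) (X i) ∈ truncIdeal k σ N 1 :=
  mk_mem_truncIdeal_one (Ideal.subset_span ⟨i, rfl⟩)

section
variable {N : ℕ} {y : σ → MvPolynomial σ k ⧸ idealOfVars σ k ^ N}

/-- A substitution tangent to the identity changes elements of order `j` only in order `j + 1`. -/
theorem aeval_sub_mk_mem_truncIdeal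
    (hy : ∀ i, y i - Ideal.Quotient.mk _ (X i) ∈ truncIdeal k σ N 2) {j : ℕ}
    {p : MvPolynomial σ k} (hp : p ∈ idealOfVars σ k ^ j) :
    aeval y p - Ideal.Quotient.mk _ p ∈ truncIdeal k σ N (j + 1) := by
  have hX := mk_X_mem_truncIdeal (k := k) (σ := σ) N
  have hy1 (i) : y i ∈ truncIdeal k σ N 1 := by
    rw [← sub_add_cancel (y i)]
    exact add_mem (truncIdeal_anti one_le_two (hy i)) (hX i)
  have h0 (p : MvPolynomial σ k) : aeval y p - Ideal.Quotient.mk _ p ∈ truncIdeal k σ N 1 := by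
    induction p using MvPolynomial.induction_on with
    | C a =>
      have h : aeval y (C a) = Ideal.Quotient.mk (idealOfVars σ k ^ N) (C a) := algHom_C _ _
      rw [h, sub_self]
      exact zero_mem _
    | add p q hp hq =>
      rw [map_add, map_add, add_sub_add_comm]
      exact add_mem hp hq
    | mul_X p i _ =>
      rw [map_mul, map_mul, aeval_X]
      exact sub_mem (Ideal.mul_mem_left _ _ (hy1 i)) (Ideal.mul_mem_left _ _ (hX i))
  have h1 {p : MvPolynomial σ k} (hp : p ∈ idealOfVars σ k) :
      aeval y p - Ideal.Quotient.mk _ p ∈ truncIdeal k σ N 2 := by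
    induction hp using Submodule.span_induction with
    | mem x hx => obtain ⟨i, rfl⟩ := hx; simpa using hy i
    | zero => simp
    | add p q _ _ hp hq =>
      rw [map_add, map_add, add_sub_add_comm]
      exact add_mem hp hq
    | smul a p hp' hp =>
      rw [smul_eq_mul, map_mul, map_mul]
      have := add_mem (Ideal.mul_mem_left _ (aeval y a) hp) (mul_mem_truncIdeal (l := 2) rfl (h0 a)
        (mk_mem_truncIdeal_one hp'))
      rwa [mul_sub, sub_mul, sub_add_sub_cancel] at this
  induction j generalizing p with
  | zero => exact h0 p
  | succ j ih =>
    rw [pow_succ] at hp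
    induction hp using Submodule.mul_induction_on' with
    | mem_mul_mem a ha b hb =>
      rw [map_mul, map_mul]
      have hb1 : aeval y b ∈ truncIdeal k σ N 1 := by
        rw [← sub_add_cancel (aeval y b) (Ideal.Quotient.mk _ b)]
        exact add_mem (truncIdeal_anti one_le_two (h1 hb)) (mk_mem_truncIdeal_one hb)
      have h2 : Ideal.Quotient.mk (idealOfVars σ k ^ N) a ∈ truncIdeal k σ N j :=
        Ideal.mem_map_of_mem _ ha
      have := add_mem (mul_mem_truncIdeal rfl (ih ha) hb1)
        (mul_mem_truncIdeal (show j + 2 = j + 1 + 1 by omega) h2 (h1 hb))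
      rwa [sub_mul, mul_sub, sub_add_sub_cancel] at this
    | add p _ q _ hp hq =>
      rw [map_add, map_add, add_sub_add_comm]
      exact add_mem hp hq

theorem mem_pow_of_aeval_mem_truncIdeal
    (hy : ∀ i, y i - Ideal.Quotient.mk _ (X i) ∈ truncIdeal k σ N 2) {j : ℕ} (hj : j ≤ N)
    {p : MvPolynomial σ k} (hp : aeval y p ∈ truncIdeal k σ N j) : p ∈ idealOfVars σ k ^ j := by
  induction j with
  | zero => simp
  | succ j ih =>
    have h := aeval_sub_mk_mem_truncIdeal hy
      (ih (by omega) (truncIdeal_anti j.le_succ hp))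
    rw [← mk_mem_truncIdeal hj]
    simpa using sub_mem hp h

/-- A substitution tangent to the identity is an automorphism of the truncated polynomial ring. -/
theorem exists_algEquiv_truncated [Finite σ]
    (hy : ∀ i, y i - Ideal.Quotient.mk _ (X i) ∈ truncIdeal k σ N 2) :
    ∃ θ : (MvPolynomial σ k ⧸ idealOfVars σ k ^ N) ≃ₐ[k] (MvPolynomial σ k ⧸ idealOfVars σ k ^ N),
      ∀ p, θ (Ideal.Quotient.mk _ p) = aeval y p := by
  have := finite_quotient_idealOfVars_pow (k := k) (σ := σ) N
  let θ : (MvPolynomial σ k ⧸ idealOfVars σ k ^ N) →ₐ[k] (MvPolynomial σ k ⧸ idealOfVars σ k ^ N) :=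
    Ideal.Quotient.liftₐ _ (aeval y) fun p hp ↦ by
      have h := aeval_sub_mk_mem_truncIdeal hy hp
      rw [Ideal.Quotient.eq_zero_iff_mem.mpr hp, sub_zero] at h
      have h' := truncIdeal_anti N.le_succ h
      rwa [truncIdeal, Ideal.map_quotient_self] at h'
  have hinj : Function.Injective θ := by
    rw [injective_iff_map_eq_zero]
    intro x hx
    obtain ⟨p, rfl⟩ := Ideal.Quotient.mk_surjective x
    refine Ideal.Quotient.eq_zero_iff_mem.mpr (mem_pow_of_aeval_mem_truncIdeal hy le_rfl ?_)
    have hx' : aeval y p = 0 := hx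
    rw [hx']
    exact zero_mem _
  have hsurj : Function.Surjective θ :=
    (LinearMap.injective_iff_surjective (f := θ.toLinearMap)).mp hinj
  exact ⟨AlgEquiv.ofBijective θ ⟨hinj, hsurj⟩, fun p ↦ rfl⟩

end

theorem finsupp_degree_lt_two {m : σ →₀ ℕ} (hm : m.degree < 2) :
    m = 0 ∨ ∃ i, m = Finsupp.single i 1 := by
  rcases (show m.degree = 0 ∨ m.degree = 1 by omega) with h | h
  · exact .inl ((Finsupp.degree_eq_zero_iff m).mp h)
  · exact .inr ((Finsupp.sum_eq_one_iff m).mp h)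

theorem sub_linear_part_mem_idealOfVars_sq [Fintype σ] [DecidableEq σ] (p : MvPolynomial σ k) :
    p - (C (p.coeff 0) + ∑ i, C (p.coeff (Finsupp.single i 1)) * X i) ∈ idealOfVars σ k ^ 2 := by
  refine (mem_pow_idealOfVars_iff' _ _).mpr fun m hm ↦ ?_
  rcases finsupp_degree_lt_two hm with rfl | ⟨i, rfl⟩
  · simp [coeff_sum, coeff_C_mul, coeff_X]
  · simp [coeff_sum, coeff_C_mul, coeff_X, Finsupp.single_left_inj, eq_comm (a := (0 : σ →₀ ℕ))]

end MvPolynomial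

open MvPolynomial

/-- A formally smooth algebra maps onto truncated polynomial rings, with prescribed coordinates `x i`:
the isomorphism of `R ⧸ I ^ 2` with the polynomials truncated at order two lifts by formal
smoothness, and a change of coordinates corrects the images of the `x i`. -/
theorem exists_surjective_truncated {k R σ : Type*} [Field k] [CommRing R] [Algebra k R]
    [Algebra.FormallySmooth k R] [Fintype σ] [DecidableEq σ] (I : Ideal R) (x : σ → R)
    (hx : ∀ i, x i ∈ I)
    (hspan : ∀ r, ∃ (c : k) (a : σ → k),
      r - (algebraMap k R c + ∑ i, algebraMap k R (a i) * x i) ∈ I ^ 2)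
    (hindep : ∀ (c : k) (a : σ → k),
      algebraMap k R c + ∑ i, algebraMap k R (a i) * x i ∈ I ^ 2 → c = 0 ∧ a = 0)
    {N : ℕ} (hN : 2 ≤ N) :
    ∃ ψ : R →ₐ[k] (MvPolynomial σ k ⧸ idealOfVars σ k ^ N), Function.Surjective ψ ∧
      (∀ i, ψ (x i) = Ideal.Quotient.mk _ (X i)) ∧ ∀ r ∈ I ^ 2, ψ r ∈ truncIdeal k σ N 2 := by
  let φ : MvPolynomial σ k →ₐ[k] R ⧸ I ^ 2 := aeval fun i ↦ Ideal.Quotient.mk _ (x i)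
  have hφ2 (p) (hp : p ∈ idealOfVars σ k ^ 2) : φ p = 0 := by
    have h1 : (idealOfVars σ k).map φ ≤ I.map (Ideal.Quotient.mk (I ^ 2)) := by
      rw [Ideal.map_span, Ideal.span_le]
      rintro _ ⟨_, ⟨i, rfl⟩, rfl⟩
      simpa [φ] using Ideal.mem_map_of_mem (Ideal.Quotient.mk (I ^ 2)) (hx i)
    have h2 := Ideal.pow_right_mono h1 2 (Ideal.map_pow φ (idealOfVars σ k) 2 ▸
      Ideal.mem_map_of_mem φ hp)
    rwa [← Ideal.map_pow, Ideal.map_quotient_self] at h2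
  have hφ1 (c : k) (a : σ → k) : φ (C c + ∑ i, C (a i) * X i) =
      Ideal.Quotient.mk _ (algebraMap k R c + ∑ i, algebraMap k R (a i) * x i) := by
    simp [φ]
  have hφker (p) (hp : φ p = 0) : p ∈ idealOfVars σ k ^ 2 := by
    have h := hφ2 _ (sub_linear_part_mem_idealOfVars_sq p)
    rw [map_sub, hp, zero_sub, neg_eq_zero, hφ1, Ideal.Quotient.eq_zero_iff_mem] at h
    obtain ⟨h0, h1⟩ := hindep _ _ h
    have h2 (i) : p.coeff (Finsupp.single i 1) = 0 := congr_fun h1 i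
    simpa [h0, h2] using sub_linear_part_mem_idealOfVars_sq p
  let g : (MvPolynomial σ k ⧸ idealOfVars σ k ^ N) →ₐ[k] R ⧸ I ^ 2 :=
    Ideal.Quotient.liftₐ _ φ fun p hp ↦ hφ2 p (Ideal.pow_le_pow_right hN hp)
  have hg (p) : g (Ideal.Quotient.mk _ p) = φ p := rfl
  have hgsurj : Function.Surjective g := by
    intro y
    obtain ⟨r, rfl⟩ := Ideal.Quotient.mk_surjective y
    obtain ⟨c, a, h⟩ := hspan r
    exact ⟨Ideal.Quotient.mk _ (C c + ∑ i, C (a i) * X i), by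
      rw [hg, hφ1]; exact (Ideal.Quotient.eq.mpr h).symm⟩
  have hgker (y) (hy : g y = 0) : y ∈ truncIdeal k σ N 2 := by
    obtain ⟨p, rfl⟩ := Ideal.Quotient.mk_surjective y
    exact Ideal.mem_map_of_mem _ (hφker p hy)
  have hnil : IsNilpotent
      (RingHom.ker (g : MvPolynomial σ k ⧸ idealOfVars σ k ^ N →+* R ⧸ I ^ 2)) := by
    refine ⟨N, ?_⟩
    rw [Ideal.zero_eq_bot, eq_bot_iff]
    refine (Ideal.pow_right_mono (fun y hy ↦ truncIdeal_anti one_le_two (hgker y hy)) N).trans ?_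
    rw [truncIdeal, ← Ideal.map_pow, pow_one, Ideal.map_quotient_self]
  let ψ₀ := Algebra.FormallySmooth.liftOfSurjective (Ideal.Quotient.mkₐ k (I ^ 2)) g hgsurj hnil
  have hψ₀ (r) : g (ψ₀ r) = Ideal.Quotient.mk _ r :=
    Algebra.FormallySmooth.liftOfSurjective_apply _ g hgsurj hnil r
  have hy (i) : ψ₀ (x i) - Ideal.Quotient.mk _ (X i) ∈ truncIdeal k σ N 2 := by
    refine hgker _ ?_
    rw [map_sub, hψ₀, hg, sub_eq_zero]
    simp [φ]
  obtain ⟨θ, hθ⟩ := exists_algEquiv_truncated hy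
  have hψX (i) : θ.symm (ψ₀ (x i)) = Ideal.Quotient.mk _ (X i) := by
    rw [AlgEquiv.symm_apply_eq, hθ, aeval_X]
  refine ⟨θ.symm.toAlgHom.comp ψ₀, fun y ↦ ?_, hψX, fun r hr ↦ ?_⟩
  · obtain ⟨p, rfl⟩ := Ideal.Quotient.mk_surjective y
    refine ⟨aeval x p, ?_⟩
    have : (θ.symm.toAlgHom.comp ψ₀).comp (aeval x) = Ideal.Quotient.mkₐ k _ := by
      ext i
      simpa using hψX i
    exact DFunLike.congr_fun this p
  · obtain ⟨p, hp⟩ := Ideal.Quotient.mk_surjective (θ.symm (ψ₀ r))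
    change θ.symm (ψ₀ r) ∈ _
    rw [← hp, mk_mem_truncIdeal hN]
    refine mem_pow_of_aeval_mem_truncIdeal hy hN ?_
    rw [← hθ, hp, AlgEquiv.apply_symm_apply]
    refine hgker _ ?_
    rw [hψ₀, Ideal.Quotient.eq_zero_iff_mem.mpr hr]

end

/-! ### Functions with dependent differentials at a rational point -/

noncomputable section

open Module

/-- Adapted coordinates for a family `v` of vectors of rank `ρ`: a basis whose first `ρ` members
are combinations `A j` of `v`, such that these combinations and some linear relations `B l`
span all coefficient vectors. -/
theorem exists_adapted_basis {k C : Type*} [Field k] [AddCommGroup C] [Module k C]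
    [FiniteDimensional k C] {n d ρ : ℕ} (hn : finrank k C = n) (v : Fin (n + 1) → C)
    (hρ : finrank k (Submodule.span k (Set.range v)) = ρ) (hd : ρ + d = n) :
    ∃ (b : Basis (Fin ρ ⊕ Fin d) k C) (A : Fin ρ → Fin (n + 1) → k)
      (B : Option (Fin d) → Fin (n + 1) → k),
      (∀ j, b (.inl j) = ∑ i, A j i • v i) ∧ (∀ l, ∑ i, B l i • v i = 0) ∧
      ∀ i, ∃ (c : Fin ρ → k) (e : Option (Fin d) → k),
        Pi.single i 1 = ∑ j, c j • A j + ∑ l, e l • B l := by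
  let F : (Fin (n + 1) → k) →ₗ[k] C := Fintype.linearCombination k v
  have hF (a) : F a = ∑ i, a i • v i := Fintype.linearCombination_apply k v a
  have hr : finrank k (LinearMap.range F) = ρ := by
    rw [← hρ, Fintype.range_linearCombination]
  have hk : finrank k (LinearMap.ker F) = Fintype.card (Option (Fin d)) := by
    have := F.finrank_range_add_finrank_ker
    rw [hr, finrank_fin_fun] at this
    simp
    omega
  obtain ⟨W, hW⟩ := (LinearMap.range F).exists_isCompl
  have hWd : finrank k W = d := by
    have := Submodule.finrank_add_eq_of_isCompl hW
    omega
  let w : Basis (Fin ρ) k (LinearMap.range F) := finBasisOfFinrankEq k _ hr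
  let w' : Basis (Fin d) k W := finBasisOfFinrankEq k _ hWd
  let B : Basis (Option (Fin d)) k (LinearMap.ker F) :=
    (finBasis k (LinearMap.ker F)).reindex (Fintype.equivOfCardEq (by simpa using hk))
  choose A hA using fun j ↦ (w j).2
  refine ⟨(w.prod w').map (Submodule.prodEquivOfIsCompl _ _ hW), A, fun l ↦ B l, fun j ↦ ?_,
    fun l ↦ ?_, fun i ↦ ?_⟩
  · simp [← hF, hA]
  · rw [← hF]; exact (B l).2
  · let y : LinearMap.range F := ⟨F (Pi.single i 1), _, rfl⟩
    have hy : F (∑ j, w.repr y j • A j) = F (Pi.single i 1) := by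
      rw [map_sum]
      simp only [map_smul, hA]
      have := congr_arg Subtype.val (w.sum_repr y)
      rwa [Submodule.coe_sum] at this
    let z : LinearMap.ker F := ⟨Pi.single i 1 - ∑ j, w.repr y j • A j, by
      rw [LinearMap.mem_ker, map_sub, hy, sub_self]⟩
    refine ⟨w.repr y, B.repr z, ?_⟩
    have := congr_arg Subtype.val (B.sum_repr z)
    rw [Submodule.coe_sum] at this
    simp only [Submodule.coe_smul] at this
    rw [this]
    simp [z]

open MvPolynomial

/-- Let `I` be a rational point of a formally smooth algebra with an `n`-dimensional cotangent
space, and let `n + 1` functions vanishing there have `n - d` independent differentials. Taking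
`n - d` of the functions as coordinates, the other `d + 1` have order two in the remaining `d`
coordinates, and `choose_le_finrank_quotient` applies to them. -/
theorem exists_ideal_choose_le_finrank {k R : Type*} [Field k] [CharZero k] [CommRing R]
    [Algebra k R] [Algebra.FormallySmooth k R] (I : Ideal R)
    (hI : Function.Bijective (algebraMap k (R ⧸ I))) {n d : ℕ}
    [FiniteDimensional k I.Cotangent]
    (hn : finrank k I.Cotangent = n) (f : Fin (n + 1) → I)
    (hd : finrank k (Submodule.span k (Set.range fun i ↦ I.toCotangent (f i))) + d = n) :
    ∃ Q : Ideal R, (∀ i, (f i : R) ∈ Q) ∧ (d + 1).choose (d / 2 + 1) ≤ finrank k (R ⧸ Q) := by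
  generalize hρ : finrank k (Submodule.span k (Set.range fun i ↦ I.toCotangent (f i))) = ρ at hd
  obtain ⟨b, A, B, hA, hB, hAB⟩ := exists_adapted_basis hn _ hρ hd
  have hsmul (c : k) (y : I) : c • I.toCotangent y = I.toCotangent (c • y) := by
    rw [← algebraMap_smul R c (I.toCotangent y), ← map_smul, algebraMap_smul]
  have hcot (y : I) : I.toCotangent y = 0 ↔ (y : R) ∈ I ^ 2 := I.toCotangent_eq_zero y
  choose x' hx' using fun j ↦ I.toCotangent_surjective (b (.inr j))
  let x : Fin ρ ⊕ Fin d → I := Sum.elim (fun j ↦ ∑ i, A j i • f i) x'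
  have hx (s) : I.toCotangent (x s) = b s := by
    rcases s with j | j
    · rw [hA]
      change I.toCotangent (∑ i, A j i • f i) = _
      rw [map_sum]
      simp only [hsmul]
    · exact hx' j
  have hlin (a : Fin ρ ⊕ Fin d → k) : I.toCotangent (∑ s, a s • x s) = ∑ s, a s • b s := by
    rw [map_sum]
    simp only [← hsmul, hx]
  have hcoe (a : Fin ρ ⊕ Fin d → k) : ((∑ s, a s • x s : I) : R) =
      ∑ s, algebraMap k R (a s) * x s := by
    rw [Submodule.coe_sum]
    simp [Algebra.smul_def]
  obtain ⟨ψ, hψ, hψx, hψ2⟩ := exists_surjective_truncated (k := k) I (fun s ↦ (x s : R))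
    (fun s ↦ (x s).2) (fun r ↦ by
      obtain ⟨c, hc⟩ := hI.2 (Ideal.Quotient.mk I r)
      have hr : r - algebraMap k R c ∈ I := Ideal.Quotient.eq.mp hc.symm
      let y : I := ⟨r - algebraMap k R c, hr⟩
      refine ⟨c, b.repr (I.toCotangent y), ?_⟩
      rw [← hcoe, ← sub_sub]
      refine (hcot (y - ∑ s, b.repr (I.toCotangent y) s • x s)).mp ?_
      rw [map_sub, hlin, b.sum_repr, sub_self])
    (fun c a h ↦ by
      rw [← hcoe] at h
      have hc : c = 0 := by
        refine hI.1 ?_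
        have h1 := sub_mem (Ideal.pow_le_self two_ne_zero h) (∑ s, a s • x s : I).2
        rw [add_sub_cancel_right] at h1
        rw [map_zero]
        exact Ideal.Quotient.eq_zero_iff_mem.mpr h1
      refine ⟨hc, ?_⟩
      rw [hc, map_zero, zero_add, ← hcot, hlin] at h
      exact funext (Fintype.linearIndependent_iff.mp b.linearIndependent a h))
    (N := d / 2 + 1 + 1) (by omega)
  -- the first `ρ` coordinates are combinations of the `f i`, so they are set to zero
  let κ : (MvPolynomial (Fin ρ ⊕ Fin d) k ⧸ idealOfVars (Fin ρ ⊕ Fin d) k ^ (d / 2 + 1 + 1)) →ₐ[k]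
      MvPolynomial (Fin d) k ⧸ idealOfVars (Fin d) k ^ (d / 2 + 1 + 1) :=
    Ideal.quotientMapₐ _ (aeval (Sum.elim 0 X)) (by
      rw [← Ideal.map_le_iff_le_comap, Ideal.map_pow]
      refine Ideal.pow_right_mono ?_ _
      rw [Ideal.map_span, Ideal.span_le]
      rintro _ ⟨_, ⟨s | s, rfl⟩, rfl⟩
      · simp
      · simpa using Ideal.subset_span (Set.mem_range_self s))
  have hκ (p) : κ (Ideal.Quotient.mk _ p) = Ideal.Quotient.mk _ (aeval (Sum.elim 0 X) p) := rfl
  have hκsurj : Function.Surjective κ := by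
    intro y
    obtain ⟨p, rfl⟩ := Ideal.Quotient.mk_surjective y
    refine ⟨Ideal.Quotient.mk _ (rename Sum.inr p), ?_⟩
    rw [hκ, aeval_rename]
    congr 1
    exact aeval_X_left_apply p
  have hκ2 (y) (hy : y ∈ truncIdeal k (Fin ρ ⊕ Fin d) (d / 2 + 1 + 1) 2) :
      κ y ∈ truncIdeal k (Fin d) (d / 2 + 1 + 1) 2 := by
    obtain ⟨p, rfl⟩ := Ideal.Quotient.mk_surjective y
    rw [mk_mem_truncIdeal (by omega)] at hy
    rw [hκ]
    refine Ideal.mem_map_of_mem _ ?_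
    have h1 : (idealOfVars (Fin ρ ⊕ Fin d) k).map
        (aeval (Sum.elim 0 X) : _ →ₐ[k] MvPolynomial (Fin d) k) ≤ idealOfVars (Fin d) k := by
      rw [Ideal.map_span, Ideal.span_le]
      rintro _ ⟨_, ⟨s | s, rfl⟩, rfl⟩
      · simp
      · simpa using Ideal.subset_span (Set.mem_range_self s)
    refine Ideal.pow_right_mono h1 2 ?_
    rw [← Ideal.map_pow]
    exact Ideal.mem_map_of_mem _ hy
  let Ψ := κ.comp ψ
  have hΨ : Function.Surjective Ψ := hκsurj.comp hψ
  -- the remaining combinations of the `f i`, which have order two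
  let h (l : Option (Fin d)) := Ψ (∑ i, B l i • f i : I)
  have hΨA (j) : Ψ (∑ i, A j i • f i : I) = 0 := by
    change κ (ψ (x (.inl j))) = 0
    rw [hψx, hκ]
    simp
  have hfh (i) : Ψ (f i) ∈ Ideal.span (Set.range h) := by
    obtain ⟨c, e, hce⟩ := hAB i
    let G : (Fin (n + 1) → k) →ₗ[k] I := Fintype.linearCombination k f
    have hG (a) : G a = ∑ i, a i • f i := Fintype.linearCombination_apply k f a
    have h1 : f i = ∑ j, c j • (∑ i, A j i • f i) + ∑ l, e l • ∑ i, B l i • f i := by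
      simp only [← hG, ← map_smul, ← map_sum, ← map_add]
      rw [← hce]
      simp [hG, Pi.single_apply, ite_smul]
    rw [h1, Submodule.coe_add, Submodule.coe_sum, Submodule.coe_sum, map_add, map_sum, map_sum]
    refine add_mem (sum_mem fun j _ ↦ ?_) (sum_mem fun l _ ↦ ?_)
    · rw [Submodule.coe_smul_of_tower, map_smul, hΨA, smul_zero]
      exact zero_mem _
    · rw [Submodule.coe_smul_of_tower, map_smul]
      exact Submodule.smul_of_tower_mem _ _ (Ideal.subset_span ⟨l, rfl⟩)
  refine ⟨(Ideal.span (Set.range h)).comap Ψ, hfh, ?_⟩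
  have key := choose_le_finrank_quotient (k := k) (σ := Fin d) (t := d / 2 + 1)
    (by simp; omega) h fun l ↦ hκ2 _ (hψ2 _ ((hcot _).mp (by
      rw [map_sum, ← hB l]
      simp only [hsmul])))
  rw [Fintype.card_fin] at key
  refine key.trans_eq (LinearEquiv.finrank_eq ?_)
  refine (AlgEquiv.ofBijective (Ideal.quotientMapₐ _ Ψ le_rfl) ⟨?_, ?_⟩).symm.toLinearEquiv
  · exact Ideal.quotientMap_injective
  · exact Ideal.quotientMap_surjective (H := le_rfl) hΨ

end

/-! ### Cotangent spaces of smooth algebras -/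

noncomputable section

open Module TensorProduct

/-- The conormal sequence at a rational point of a formally smooth algebra: the cotangent space is
the fiber of the module of differentials. -/
theorem exists_linearEquiv_cotangent {k R κ : Type*} [Field k] [CommRing R] [Field κ]
    [Algebra k R] [Algebra R κ] [Algebra k κ] [IsScalarTower k R κ] [Algebra.FormallySmooth k R]
    (hκ : Function.Bijective (algebraMap k κ)) (I : Ideal R)
    (hI : I = RingHom.ker (algebraMap R κ)) :
    Nonempty (I.Cotangent ≃ₗ[k] κ ⊗[R] Ω[R⁄k]) := by
  subst hI
  have hsurj : Function.Surjective (algebraMap R κ) := by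
    intro x
    obtain ⟨c, rfl⟩ := hκ.2 x
    exact ⟨algebraMap k R c, (IsScalarTower.algebraMap_apply k R κ c).symm⟩
  let e : k ≃ₐ[k] κ := AlgEquiv.ofBijective (Algebra.ofId k κ) hκ
  have hs : Algebra.FormallySmooth k κ := .of_equiv e
  have : Subsingleton Ω[κ⁄k] := by
    have : Algebra.FormallyUnramified k κ := .of_equiv e
    infer_instance
  obtain ⟨l, hl⟩ := (Algebra.FormallySmooth.iff_split_injection (R := k) hsurj).mp hs
  refine ⟨(LinearEquiv.ofBijective (KaehlerDifferential.kerCotangentToTensor k R κ)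
    ⟨fun x y h ↦ ?_, fun x ↦ ?_⟩).restrictScalars k⟩
  · rw [← LinearMap.id_apply (R := R) x, ← LinearMap.id_apply (R := R) y, ← hl,
      LinearMap.comp_apply, h, LinearMap.comp_apply]
  · exact (KaehlerDifferential.exact_kerCotangentToTensor_mapBaseChange k R κ hsurj x).mp
      (Subsingleton.elim _ _)

open IsLocalRing in
/-- At a rational point of a smooth algebra of relative dimension `n`, the local ring is formally smooth
and has an `n`-dimensional cotangent space. -/
theorem cotangentSpace_of_isStandardSmooth {k A R : Type*} [Field k] [CommRing A] [CommRing R]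
    [IsLocalRing R] [Algebra k A] [Algebra A R] [Algebra k R] [IsScalarTower k A R]
    (n : ℕ) [Algebra.IsStandardSmoothOfRelativeDimension n k A] (M : Submonoid A)
    [IsLocalization M R] (hκ : Function.Bijective (algebraMap k (ResidueField R))) :
    Algebra.FormallySmooth k R ∧ FiniteDimensional k (CotangentSpace R) ∧
      finrank k (CotangentSpace R) = n := by
  have : Nontrivial A := (algebraMap A R).domain_nontrivial
  have := Algebra.IsStandardSmoothOfRelativeDimension.isStandardSmooth (R := k) (S := A) n
  have : Algebra.FormallyEtale A R := .of_isLocalization M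
  have : Algebra.FormallySmooth k R := .comp k A R
  have hr : Module.rank A Ω[A⁄k] = n :=
    Algebra.IsStandardSmoothOfRelativeDimension.rank_kaehlerDifferential n
  have : Module.Finite A Ω[A⁄k] := by
    rw [← Module.rank_lt_aleph0_iff, hr]
    exact Cardinal.natCast_lt_aleph0
  have e := KaehlerDifferential.tensorKaehlerEquivOfFormallyEtale k A R
  have : Module.Free R Ω[R⁄k] := .of_equiv e
  have : Module.Finite R Ω[R⁄k] := .equiv e
  have hR : finrank R Ω[R⁄k] = n := by
    rw [← e.finrank_eq, finrank_baseChange]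
    exact finrank_eq_of_rank_eq hr
  obtain ⟨e'⟩ := exists_linearEquiv_cotangent (k := k) hκ (maximalIdeal R) (by
    exact (ker_residue (R := R)).symm)
  have hk1 : finrank k (ResidueField R) = 1 := by
    rw [← (LinearEquiv.ofBijective (Algebra.linearMap k (ResidueField R)) hκ).finrank_eq,
      finrank_self]
  have : FiniteDimensional k (ResidueField R) := .of_finrank_pos (by omega)
  have : Module.Finite k (ResidueField R ⊗[R] Ω[R⁄k]) := .trans (ResidueField R) _
  refine ⟨inferInstance, .equiv e'.symm, ?_⟩
  rw [e'.finrank_eq, ← finrank_mul_finrank k (ResidueField R), hk1, finrank_baseChange, hR,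
    one_mul]

end

/-! ### The rank of the differential -/

noncomputable section

open Module IsLocalRing

namespace LinProj

section
variable {A B : Type u} [CommRing A] [CommRing B] [IsLocalRing A] [IsLocalRing B]

theorem cotangentMap_toCotangent (f : A →+* B) [IsLocalHom f] (a : maximalIdeal A) :
    cotangentMap f ((maximalIdeal A).toCotangent a) =
      (maximalIdeal B).toCotangent ⟨f a, maximalIdeal_le_comap f a.2⟩ :=
  rfl

/-- The rank of the differential is the rank of its transpose. -/
theorem finrank_range_tangentMap (f : A →+* B) [IsLocalHom f]
    [FiniteDimensional (ResidueField B) (CotangentSpace B)] :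
    finrank (ResidueField B) (LinearMap.range (tangentMap f)) =
      finrank (ResidueField B) (Submodule.span (ResidueField B) (Set.range (cotangentMap f))) := by
  have hker : LinearMap.ker (tangentMap f) =
      (Submodule.span (ResidueField B) (Set.range (cotangentMap f))).dualAnnihilator := by
    ext v
    rw [LinearMap.mem_ker, Submodule.mem_dualAnnihilator]
    constructor
    · intro hv w hw
      induction hw using Submodule.span_induction with
      | mem x hx => obtain ⟨y, rfl⟩ := hx; exact congr($hv y)
      | zero => simp
      | add x y _ _ hx hy => rw [map_add, hx, hy, add_zero]
      | smul c x _ hx => rw [map_smul, hx, smul_zero]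
    · exact fun hv ↦ LinearMap.ext fun y ↦ hv _ (Submodule.subset_span ⟨y, rfl⟩)
  have h1 := LinearMap.finrank_range_add_finrank_ker (tangentMap f)
  have h2 := Subspace.finrank_add_finrank_dualAnnihilator_eq
    (Submodule.span (ResidueField B) (Set.range (cotangentMap f)))
  rw [Subspace.dual_finrank_eq, hker] at h1
  omega

theorem isScalarTower_cotangentSpace (k : Type*) [Field k] [Algebra k B] :
    IsScalarTower k (ResidueField B) (CotangentSpace B) where
  smul_assoc c x v := by
    obtain ⟨b, rfl⟩ := residue_surjective x
    have h (b : B) : residue B b • v = b • v := algebraMap_smul (ResidueField B) b v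
    have h1 : c • residue B b = residue B (c • b) := by
      rw [Algebra.smul_def, Algebra.smul_def, map_mul]
      rfl
    rw [h1, h, h, smul_assoc]

/-- When the maximal ideal of `A` has generators `a i` and `k` is the residue field of `B`, the rank
of the differential is the rank of the cotangent vectors of the `f (a i)`. -/
theorem finrank_range_tangentMap_eq_finrank_span {k ι : Type*} [Field k] [Algebra k B] [Fintype ι]
    (f : A →+* B) [IsLocalHom f]
    (hκ : Function.Bijective (algebraMap k (ResidueField B)))
    [FiniteDimensional k (CotangentSpace B)]
    (a : ι → maximalIdeal A) (ha : Ideal.span (Set.range fun i ↦ (a i : A)) = maximalIdeal A) :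
    finrank (ResidueField B) (LinearMap.range (tangentMap f)) =
      finrank k (Submodule.span k (Set.range fun i ↦
        (maximalIdeal B).toCotangent ⟨f (a i), maximalIdeal_le_comap f (a i).2⟩)) := by
  have := isScalarTower_cotangentSpace (B := B) k
  have : FiniteDimensional (ResidueField B) (CotangentSpace B) :=
    .of_restrictScalars_finite k _ _
  have hspan : Submodule.span (ResidueField B) (Set.range (cotangentMap f)) =
      Submodule.span (ResidueField B) (Set.range fun i ↦
        (maximalIdeal B).toCotangent ⟨f (a i), maximalIdeal_le_comap f (a i).2⟩) := by
    refine le_antisymm (Submodule.span_le.mpr ?_) (Submodule.span_mono ?_)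
    · rintro _ ⟨y, rfl⟩
      obtain ⟨y, rfl⟩ := Ideal.toCotangent_surjective _ y
      obtain ⟨c, hc⟩ := Ideal.mem_span_range_iff_exists_fun.mp (ha.ge y.2)
      have hy : y = ∑ i, c i • a i := Subtype.ext (by
        rw [Submodule.coe_sum]; exact hc.symm)
      rw [hy, map_sum, map_sum]
      refine sum_mem fun i _ ↦ ?_
      rw [map_smul, ← algebraMap_smul (ResidueField A) (c i), LinearMap.map_smulₛₗ,
        cotangentMap_toCotangent]
      exact Submodule.smul_mem _ _ (Submodule.subset_span ⟨i, rfl⟩)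
    · rintro _ ⟨i, rfl⟩
      exact ⟨_, cotangentMap_toCotangent f (a i)⟩
  rw [finrank_range_tangentMap, hspan,
    ← Submodule.restrictScalars_span k (ResidueField B) hκ.2]
  have hk1 : finrank k (ResidueField B) = 1 := by
    rw [← (LinearEquiv.ofBijective (Algebra.linearMap k (ResidueField B)) hκ).finrank_eq,
      finrank_self]
  have h := finrank_mul_finrank k (ResidueField B) (Submodule.span (ResidueField B)
    (Set.range fun i ↦
      (maximalIdeal B).toCotangent ⟨f (a i), maximalIdeal_le_comap f (a i).2⟩))
  rw [hk1, one_mul] at h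
  exact h

end
end LinProj

end

/-! ### Local rings and degrees of schemes over a field -/

noncomputable section

open Module IsLocalRing

namespace LinProj

section
variable {k : Type u} [Field k] {X : Scheme.{u}}

/-- The ring homomorphism from `k` to the local ring at a point `p` of a `k`-scheme. -/
def toStalk (s : X ⟶ Spec (.of k)) (p : X) : CommRingCat.of k ⟶ X.presheaf.stalk p :=
  Spec.preimage (X.fromSpecStalk p ≫ s)

theorem SpecMap_toStalk (s : X ⟶ Spec (.of k)) (p : X) :
    Spec.map (toStalk s p) = X.fromSpecStalk p ≫ s :=
  Spec.map_preimage _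

/-- The local ring at a point of a `k`-scheme, as a `k`-algebra. -/
@[reducible]
def stalkAlgebra (s : X ⟶ Spec (.of k)) (p : X) : Algebra k (X.presheaf.stalk p) :=
  (toStalk s p).hom.toAlgebra

theorem toStalk_eq (s : X ⟶ Spec (.of k)) {V : X.Opens} (hV : IsAffineOpen V) {p : X} (hp : p ∈ V)
    (e : V ≤ s ⁻¹ᵁ ⊤) :
    toStalk s p = (Scheme.ΓSpecIso (.of k)).inv ≫ s.appLE ⊤ V e ≫ X.presheaf.germ V p hp := by
  apply Spec.map_injective
  rw [SpecMap_toStalk, ← hV.fromSpecStalk_eq_fromSpecStalk hp, IsAffineOpen.fromSpecStalk,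
    Category.assoc, ← IsAffineOpen.SpecMap_appLE_fromSpec s (isAffineOpen_top _) hV e,
    IsAffineOpen.fromSpec_top, Scheme.isoSpec_Spec_inv, Spec.map_comp, Spec.map_comp,
    Category.assoc]

/-- At a closed point of a scheme over an algebraically closed field, the residue field is `k`. -/
theorem bijective_algebraMap_residueField [IsAlgClosed k] (s : X ⟶ Spec (.of k))
    [LocallyOfFiniteType s] (p : X) (hp : IsClosed {p}) :
    Function.Bijective (X.residue p |>.hom.comp (toStalk s p).hom) := by
  have h : toStalk s p ≫ X.residue p = (residueFieldIsoBase s p hp).inv := by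
    apply Spec.map_injective
    rw [Spec.map_comp, SpecMap_toStalk, SpecMap_residueFieldIsoBase_inv]
    rfl
  have h2 : Function.Bijective (residueFieldIsoBase s p hp).inv.hom :=
    ConcreteCategory.bijective_of_isIso (residueFieldIsoBase s p hp).inv
  rw [← h] at h2
  exact h2

theorem cotangentSpace_stalk_of_smooth [IsAlgClosed k] (s : X ⟶ Spec (.of k)) (n : ℕ)
    [SmoothOfRelativeDimension n s] (p : X) (hp : IsClosed {p}) :
    letI := stalkAlgebra s p
    Function.Bijective (algebraMap k (ResidueField (X.presheaf.stalk p))) ∧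
    Algebra.FormallySmooth k (X.presheaf.stalk p) ∧
      FiniteDimensional k (CotangentSpace (X.presheaf.stalk p)) ∧
      finrank k (CotangentSpace (X.presheaf.stalk p)) = n := by
  let := stalkAlgebra s p
  have := SmoothOfRelativeDimension.smooth n s
  have hκ : Function.Bijective (algebraMap k (ResidueField (X.presheaf.stalk p))) :=
    bijective_algebraMap_residueField s p hp
  refine ⟨hκ, ?_⟩
  obtain ⟨U, hU, V, hV, hpV, e, hs⟩ :=
    SmoothOfRelativeDimension.exists_isStandardSmoothOfRelativeDimension (n := n) (f := s) p
  obtain rfl : U = ⊤ := by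
    have hmem : s p ∈ U := e hpV
    ext x
    simp only [TopologicalSpace.Opens.coe_top, Set.mem_univ, iff_true]
    rwa [Subsingleton.elim (α := PrimeSpectrum k) x (s p)]
  let : Algebra k Γ(X, V) :=
    ((Scheme.ΓSpecIso (.of k)).inv ≫ s.appLE ⊤ V e).hom.toAlgebra
  let : Algebra Γ(X, V) (X.presheaf.stalk p) := (X.presheaf.germ V p hpV).hom.toAlgebra
  have : IsScalarTower k Γ(X, V) (X.presheaf.stalk p) := by
    refine .of_algebraMap_eq' ?_
    have := toStalk_eq s hV hpV e
    rw [← Category.assoc] at this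
    exact congr(($this).hom)
  have : Algebra.IsStandardSmoothOfRelativeDimension n k Γ(X, V) := by
    have := RingHom.isStandardSmoothOfRelativeDimension_respectsIso.2 _
      (Scheme.ΓSpecIso (.of k)).symm.commRingCatIsoToRingEquiv hs
    exact this
  have : IsLocalization (hV.primeIdealOf ⟨p, hpV⟩).asIdeal.primeCompl (X.presheaf.stalk p) :=
    hV.isLocalization_stalk ⟨p, hpV⟩
  exact cotangentSpace_of_isStandardSmooth n (hV.primeIdealOf ⟨p, hpV⟩).asIdeal.primeCompl hκ

end

section degree
variable {k : Type u} [Field k]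

theorem degree_SpecMap {R : CommRingCat.{u}} (φ : CommRingCat.of k ⟶ R) :
    letI := φ.hom.toAlgebra
    degree (Spec.map φ) = finrank k R := by
  let := φ.hom.toAlgebra
  let : Algebra k Γ(Spec R, ⊤) :=
    ((Scheme.ΓSpecIso (.of k)).inv ≫ (Spec.map φ).appTop).hom.toAlgebra
  have h : φ ≫ (Scheme.ΓSpecIso R).inv = (Scheme.ΓSpecIso (.of k)).inv ≫ (Spec.map φ).appTop :=
    Scheme.ΓSpecIso_inv_naturality φ
  let e : R ≃ₐ[k] Γ(Spec R, ⊤) :=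
    AlgEquiv.ofRingEquiv (f := (Scheme.ΓSpecIso R).symm.commRingCatIsoToRingEquiv)
      fun x ↦ congr(($h).hom x)
  exact e.toLinearEquiv.finrank_eq.symm

/-- A closed subscheme of a finite `k`-scheme has smaller degree. -/
theorem degree_comp_le {W Z : Scheme.{u}} (j : W ⟶ Z) [IsClosedImmersion j]
    (s : Z ⟶ Spec (.of k)) [IsFinite s] : degree (j ≫ s) ≤ degree s := by
  let : Algebra k Γ(Z, ⊤) := ((Scheme.ΓSpecIso (.of k)).inv ≫ s.appTop).hom.toAlgebra
  let : Algebra k Γ(W, ⊤) := ((Scheme.ΓSpecIso (.of k)).inv ≫ (j ≫ s).appTop).hom.toAlgebra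
  have : IsAffine Z := isAffine_of_isAffineHom s
  have hj := (IsClosedImmersion.isAffine_surjective_of_isAffine j).2
  have hfin : ((Scheme.ΓSpecIso (.of k)).inv ≫ s.appTop).hom.Finite := by
    rw [CommRingCat.hom_comp]
    exact s.finite_appTop.comp (.of_surjective _
      (ConcreteCategory.bijective_of_isIso (Scheme.ΓSpecIso (.of k)).inv).2)
  have : Module.Finite k Γ(Z, ⊤) := hfin
  let g : Γ(Z, ⊤) →ₐ[k] Γ(W, ⊤) :=
    { j.appTop.hom with
      commutes' := fun x ↦ by
        change (((Scheme.ΓSpecIso (.of k)).inv ≫ s.appTop) ≫ j.appTop).hom x = _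
        rw [Category.assoc, ← Scheme.Hom.comp_appTop]
        rfl }
  exact LinearMap.finrank_le_finrank_of_surjective (f := g.toLinearMap) hj

end degree
end LinProj

end

/-! ### Fibers of finite morphisms -/

noncomputable section

open Module IsLocalRing

namespace LinProj

section
variable {k : Type u} [Field k] {X Y : Scheme.{u}}

/-- The fiber of a finite morphism over a closed point is finite over `k`, because the residue field of
the point is `k`. -/
theorem isFinite_fiberι_comp [IsAlgClosed k] (π : X ⟶ Y) [IsFinite π] (sY : Y ⟶ Spec (.of k))
    [LocallyOfFiniteType sY] (y : Y) (hy : IsClosed {y}) :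
    IsFinite (π.fiberι y ≫ π ≫ sY) := by
  rw [← Category.assoc, Scheme.Hom.fiber_fac, Category.assoc,
    ← SpecMap_residueFieldIsoBase_inv sY y hy]
  have : IsFinite (π.fiberToSpecResidueField y) := by
    unfold Scheme.Hom.fiberToSpecResidueField Scheme.Hom.fiber; infer_instance
  infer_instance

/-- Quotients of the local ring at `p` in which the maximal ideal at `π p` becomes zero are closed
subschemes of the fiber, as long as they are finite over `k`. -/
theorem exists_closedImmersion_fiber (π : X ⟶ Y) (s : X ⟶ Spec (.of k)) (p : X)
    [IsFinite (π.fiberι (π p) ≫ s)] (Q : Ideal (X.presheaf.stalk p))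
    (hQ : ∀ a ∈ maximalIdeal (Y.presheaf.stalk (π p)), (π.stalkMap p).hom a ∈ Q)
    (hfin : ((CommRingCat.ofHom (Ideal.Quotient.mk Q)).hom.comp (toStalk s p).hom).Finite) :
    ∃ j : Spec (.of (X.presheaf.stalk p ⧸ Q)) ⟶ π.fiber (π p), IsClosedImmersion j ∧
      j ≫ π.fiberι (π p) = Spec.map (CommRingCat.ofHom (Ideal.Quotient.mk Q)) ≫
        X.fromSpecStalk p := by
  let q : X.presheaf.stalk p ⟶ .of (X.presheaf.stalk p ⧸ Q) :=
    CommRingCat.ofHom (Ideal.Quotient.mk Q)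
  let δ : Y.residueField (π p) ⟶ .of (X.presheaf.stalk p ⧸ Q) :=
    CommRingCat.ofHom (Ideal.Quotient.lift (maximalIdeal (Y.presheaf.stalk (π p)))
      (q.hom.comp (π.stalkMap p).hom) fun a ha ↦ Ideal.Quotient.eq_zero_iff_mem.mpr (hQ a ha))
  have hδ : Y.residue (π p) ≫ δ = π.stalkMap p ≫ q := by
    ext a
    rfl
  have hcomm : (Spec.map q ≫ X.fromSpecStalk p) ≫ π =
      Spec.map δ ≫ Y.fromSpecResidueField (π p) := by
    rw [Scheme.fromSpecResidueField, ← Spec.map_comp_assoc, hδ, Spec.map_comp, Category.assoc,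
      Category.assoc, Scheme.SpecMap_stalkMap_fromSpecStalk]
  let j : Spec (.of (X.presheaf.stalk p ⧸ Q)) ⟶ π.fiber (π p) :=
    Limits.pullback.lift (Spec.map q ≫ X.fromSpecStalk p) (Spec.map δ) hcomm
  have hj : j ≫ π.fiberι (π p) = Spec.map q ≫ X.fromSpecStalk p :=
    Limits.pullback.lift_fst _ _ _
  refine ⟨j, ?_, hj⟩
  have : IsClosedImmersion (Spec.map q) := .spec_of_surjective q Ideal.Quotient.mk_surjective
  have hm : Mono (j ≫ π.fiberι (π p)) := by
    rw [hj]; infer_instance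
  have : Mono j := mono_of_mono j (π.fiberι (π p))
  have : IsFinite (j ≫ π.fiberι (π p) ≫ s) := by
    rw [reassoc_of% hj, ← SpecMap_toStalk, ← Spec.map_comp, IsFinite.SpecMap_iff]
    exact hfin
  have : IsFinite j := .of_comp j (π.fiberι (π p) ≫ s)
  exact (IsClosedImmersion.iff_isFinite_and_mono j).mpr ⟨inferInstance, inferInstance⟩

theorem natCeil_half (d : ℕ) : ⌈(d : ℚ) / 2⌉₊ = (d + 1) / 2 := by
  have h1 : ((d : ℚ) / 2) ≤ ⌈(d : ℚ) / 2⌉₊ := Nat.le_ceil _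
  have h2 : d ≤ 2 * ⌈(d : ℚ) / 2⌉₊ := by
    rw [div_le_iff₀ two_pos, mul_comm] at h1
    exact_mod_cast h1
  have h3 : d ≤ 2 * ((d + 1) / 2) := by omega
  refine le_antisymm (Nat.ceil_le.mpr ?_) (by omega)
  rw [div_le_iff₀ two_pos, mul_comm]
  exact_mod_cast h3

/-- The degree of the fiber of a finite morphism through a closed point `p` at which it has corank
`d`, when the source is smooth of dimension `n` and the maximal ideal at the image of `p` has
`n + 1` generators. Only the quotient of the fiber given by `exists_ideal_choose_le_finrank` is used
for the bound. -/
theorem isFinite_and_choose_le_degree_fiber [IsAlgClosed k] [CharZero k] {n d : ℕ} (π : X ⟶ Y)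
    [IsFinite π] (sY : Y ⟶ Spec (.of k)) [LocallyOfFiniteType sY]
    [SmoothOfRelativeDimension n (π ≫ sY)] (p : X) (hp : IsClosed {p})
    (a : Fin (n + 1) → maximalIdeal (Y.presheaf.stalk (π p)))
    (ha : Ideal.span (Set.range fun i ↦ (a i : Y.presheaf.stalk (π p))) =
      maximalIdeal (Y.presheaf.stalk (π p)))
    (hd : tangentRank π p + d = n) :
    IsFinite (π.fiberι (π p) ≫ π ≫ sY) ∧
      (d + 1).choose ⌈(d : ℚ) / 2⌉₊ ≤ degree (π.fiberι (π p) ≫ π ≫ sY) := by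
  have hy : IsClosed {π p} := by
    simpa using π.isClosedMap _ hp
  have hZ := isFinite_fiberι_comp π sY (π p) hy
  refine ⟨hZ, ?_⟩
  set s := π ≫ sY with hs
  let := stalkAlgebra s p
  obtain ⟨hκ, h1, h2, h3⟩ := cotangentSpace_stalk_of_smooth s n p hp
  rw [tangentRank, finrank_range_tangentMap_eq_finrank_span _ hκ a ha] at hd
  obtain ⟨Q, hQ, hc⟩ := exists_ideal_choose_le_finrank (maximalIdeal (X.presheaf.stalk p)) hκ h3 _
    hd
  have hpos : 0 < finrank k (X.presheaf.stalk p ⧸ Q) :=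
    (Nat.choose_pos (by omega)).trans_le hc
  have hfin : FiniteDimensional k (X.presheaf.stalk p ⧸ Q) := .of_finrank_pos hpos
  obtain ⟨j, hj, hjs⟩ := exists_closedImmersion_fiber π s p Q (by
    intro b hb
    rw [← ha] at hb
    change b ∈ Q.comap (π.stalkMap p).hom
    refine Ideal.span_le.mpr ?_ hb
    rintro _ ⟨i, rfl⟩
    exact hQ i) hfin
  have h := degree_comp_le j (π.fiberι (π p) ≫ s)
  rw [reassoc_of% hjs, ← SpecMap_toStalk, ← Spec.map_comp, degree_SpecMap] at h
  refine le_trans ?_ (hc.trans h)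
  -- `d + 1 - (d / 2 + 1) = ⌈d / 2⌉`: the two binomial coefficients agree by symmetry
  rw [natCeil_half, ← Nat.choose_symm (by omega)]
  exact (congrArg _ (by omega)).le

end
end LinProj

end

/-! ### Linear projections are finite -/

noncomputable section

open Module IsLocalRing

namespace LinProj

attribute [local instance] MvPolynomial.gradedAlgebra

section
variable {k : Type u} [Field k] {r m : ℕ}

theorem adjoin_X_eq_top (k : Type u) [Field k] (N : ℕ) :
    Algebra.adjoin (grading k N 0)
      (Set.range (MvPolynomial.X : Fin (N + 1) → MvPolynomial (Fin (N + 1)) k)) = ⊤ := by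
  refine top_le_iff.mp fun x _ ↦ ?_
  induction x using MvPolynomial.induction_on with
  | C a => exact Subalgebra.algebraMap_mem _ (⟨MvPolynomial.C a, MvPolynomial.isHomogeneous_C _ a⟩ :
      grading k N 0)
  | add p q hp hq => exact add_mem (hp trivial) (hq trivial)
  | mul_X p i hp => exact mul_mem (hp trivial) (Algebra.subset_adjoin ⟨i, rfl⟩)

theorem bijective_algebraMap_grading_zero (k : Type u) [Field k] (N : ℕ) :
    Function.Bijective (algebraMap k (grading k N 0)) := by
  refine ⟨fun a b h ↦ MvPolynomial.C_injective _ _ congr(($h : MvPolynomial (Fin (N + 1)) k)),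
    fun x ↦ ?_⟩
  obtain ⟨x, hx⟩ := x
  obtain ⟨a, rfl⟩ : ∃ a, MvPolynomial.C a = x :=
    ⟨_, (MvPolynomial.totalDegree_eq_zero_iff_eq_C.mp
      (Nat.le_zero.mp (MvPolynomial.IsHomogeneous.totalDegree_le hx))).symm⟩
  exact ⟨a, rfl⟩

instance finiteType_grading_zero (k : Type u) [Field k] (N : ℕ) :
    Algebra.FiniteType (grading k N 0) (MvPolynomial (Fin (N + 1)) k) := by
  classical exact ⟨⟨Finset.univ.image MvPolynomial.X, by simpa using adjoin_X_eq_top k N⟩⟩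

instance isIso_SpecMap_algebraMap (k : Type u) [Field k] (N : ℕ) :
    IsIso (Spec.map (CommRingCat.ofHom (algebraMap k (grading k N 0)))) := by
  have : IsIso (CommRingCat.ofHom (algebraMap k (grading k N 0))) := by
    rw [ConcreteCategory.isIso_iff_bijective]
    exact bijective_algebraMap_grading_zero k N
  infer_instance

instance isProper_toSpec (k : Type u) [Field k] (N : ℕ) : IsProper (PSpace.toSpec k N) := by
  unfold PSpace.toSpec
  infer_instance

theorem iSup_basicOpen_X_eq_top (k : Type u) [Field k] (N : ℕ) :
    ⨆ i, Proj.basicOpen (grading k N) (MvPolynomial.X i) = ⊤ :=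
  Proj.iSup_basicOpen_eq_top' _ _ (fun i ↦ ⟨1, X_mem k i⟩) (adjoin_X_eq_top k N)

theorem basicOpenToSpec_awayι {d : ℕ} {f : MvPolynomial (Fin (m + 1)) k} (hf : f ∈ grading k m d)
    (hd : 0 < d) :
    Proj.basicOpenToSpec (grading k m) f ≫ Proj.awayι (grading k m) f hf hd =
      (Proj.basicOpen (grading k m) f).ι := by
  rw [← Proj.basicOpenIsoSpec_hom _ _ hf hd, Proj.awayι, Iso.hom_inv_id_assoc]

theorem projectionAway_preimage (L : Fin (m + 1) → Fin (r + 1) → k) {d e : ℕ}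
    {f g : MvPolynomial (Fin (m + 1)) k} (hf : f ∈ grading k m d) (hd : 0 < d)
    (hg : g ∈ grading k m e) (he : 0 < e) :
    projectionAway L f hf hd ⁻¹ᵁ Proj.basicOpen (grading k m) g =
      (Proj.basicOpen (grading k r) (coordHom L f)).ι ⁻¹ᵁ
        Proj.basicOpen (grading k r) (coordHom L g) := by
  have hf' : coordHom L f ∈ grading k r d := (coordHom L).map_mem hf
  have hg' : coordHom L g ∈ grading k r e := (coordHom L).map_mem hg
  have hmap : HomogeneousLocalization.Away.map (coordHom L).toGradedRingHom f
      (HomogeneousLocalization.Away.isLocalizationElem hf hg) =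
      HomogeneousLocalization.Away.isLocalizationElem hf' hg' := by
    rw [HomogeneousLocalization.Away.map_mk]
    ext
    simp only [HomogeneousLocalization.Away.val_mk]
    congr 1
    exact map_pow (coordHom L) g d
  rw [← basicOpenToSpec_awayι hf' hd, projectionAway, Scheme.Hom.comp_preimage,
    Scheme.Hom.comp_preimage, Scheme.Hom.comp_preimage,
    Proj.awayι_preimage_basicOpen _ hf hd hg he, Proj.awayι_preimage_basicOpen _ hf' hd hg' he,
    ← hmap]
  rfl

theorem projectionAway_toSpec (L : Fin (m + 1) → Fin (r + 1) → k) {d : ℕ}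
    {f : MvPolynomial (Fin (m + 1)) k} (hf : f ∈ grading k m d) (hd : 0 < d) :
    projectionAway L f hf hd ≫ PSpace.toSpec k m =
      (Proj.basicOpen (grading k r) (coordHom L f)).ι ≫ PSpace.toSpec k r := by
  have hf' : coordHom L f ∈ grading k r d := (coordHom L).map_mem hf
  have h : ((HomogeneousLocalization.Away.map (coordHom L).toGradedRingHom f).comp
      (HomogeneousLocalization.fromZeroRingHom (grading k m) _)).comp
        (algebraMap k (grading k m 0)) =
      (HomogeneousLocalization.fromZeroRingHom (grading k r) (.powers (coordHom L f))).comp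
        (algebraMap k (grading k r 0)) := by
    ext a
    change Localization.mk (coordHom L (MvPolynomial.C a)) ⟨coordHom L 1, _⟩ =
      Localization.mk (MvPolynomial.C a) ⟨1, _⟩
    congr 1
    · exact MvPolynomial.aeval_C _ a
    · exact Subtype.ext (map_one (coordHom L))
  rw [← basicOpenToSpec_awayι hf' hd, projectionAway, PSpace.toSpec, PSpace.toSpec]
  simp only [Category.assoc, Proj.awayι_toSpecZero_assoc, ← Spec.map_comp, ← CommRingCat.ofHom_comp,
    ← h]

theorem projection_toSpec (L : Fin (m + 1) → Fin (r + 1) → k) :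
    projection L ≫ PSpace.toSpec k m = (centerCompl L).ι ≫ PSpace.toSpec k r := by
  refine (Scheme.Opens.iSupOpenCover fun i ↦ nonvanishing (L i)).hom_ext _ _ fun i ↦ ?_
  have h := homOfLE_projection L i
  change (PSpace k r).homOfLE (nonvanishing_le L i) ≫ _ =
    (PSpace k r).homOfLE (nonvanishing_le L i) ≫ _
  rw [reassoc_of% h, Scheme.homOfLE_ι_assoc]
  unfold projectionPiece
  rw [Category.assoc, projectionAway_toSpec, Scheme.homOfLE_ι_assoc]

theorem projection_preimage (L : Fin (m + 1) → Fin (r + 1) → k) (i : Fin (m + 1)) :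
    projection L ⁻¹ᵁ Proj.basicOpen (grading k m) (MvPolynomial.X i) =
      (centerCompl L).ι ⁻¹ᵁ nonvanishing (L i) := by
  ext x
  obtain ⟨j, hj⟩ := TopologicalSpace.Opens.mem_iSup.mp x.2
  let y : (nonvanishing (L j)).toScheme := ⟨x.1, hj⟩
  have hy : (PSpace k r).homOfLE (nonvanishing_le L j) y = x :=
    Subtype.ext (Scheme.homOfLE_apply ..)
  have h1 : (PSpace k r).homOfLE (nonvanishing_le L j) ⁻¹ᵁ
        projection L ⁻¹ᵁ Proj.basicOpen (grading k m) (MvPolynomial.X i) =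
      (PSpace k r).homOfLE (nonvanishing_le L j) ⁻¹ᵁ
        (centerCompl L).ι ⁻¹ᵁ nonvanishing (L i) := by
    rw [← Scheme.Hom.comp_preimage, ← Scheme.Hom.comp_preimage, homOfLE_projection,
      Scheme.homOfLE_ι, projectionPiece, Scheme.Hom.comp_preimage,
      projectionAway_preimage L (X_mem k j) one_pos (X_mem k i) one_pos,
      ← Scheme.Hom.comp_preimage, Scheme.homOfLE_ι, ← basicOpen_coordHom_X]
  have h2 := congr(y ∈ $h1)
  rw [← hy]
  exact h2.to_iff

theorem projectionOn_toSpec (L : Fin (m + 1) → Fin (r + 1) → k) {X : Scheme.{u}}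
    (ι : X ⟶ PSpace k r) (h : Disjoint (Set.range ι) (center L)) :
    projectionOn L ι h ≫ PSpace.toSpec k m = ι ≫ PSpace.toSpec k r := by
  rw [projectionOn, Category.assoc, projection_toSpec, IsOpenImmersion.lift_fac_assoc]

theorem projectionOn_preimage (L : Fin (m + 1) → Fin (r + 1) → k) {X : Scheme.{u}}
    (ι : X ⟶ PSpace k r) (h : Disjoint (Set.range ι) (center L)) (i : Fin (m + 1)) :
    projectionOn L ι h ⁻¹ᵁ Proj.basicOpen (grading k m) (MvPolynomial.X i) =
      ι ⁻¹ᵁ nonvanishing (L i) := by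
  rw [projectionOn, Scheme.Hom.comp_preimage, projection_preimage, ← Scheme.Hom.comp_preimage,
    IsOpenImmersion.lift_fac]

/-- The projection of a closed subscheme of projective space from a centre it does not meet is a
finite morphism: it is proper, and it is affine because `D₊(ℓᵢ)` is affine. -/
theorem isFinite_projectionOn (L : Fin (m + 1) → Fin (r + 1) → k) {X : Scheme.{u}}
    (ι : X ⟶ PSpace k r) [IsClosedImmersion ι] (h : Disjoint (Set.range ι) (center L)) :
    IsFinite (projectionOn L ι h) := by
  rw [IsFinite.iff_isProper_and_isAffineHom]
  constructor
  · have : IsProper (projectionOn L ι h ≫ PSpace.toSpec k m) := by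
      rw [projectionOn_toSpec]; infer_instance
    exact .of_comp _ (PSpace.toSpec k m)
  · refine isAffineHom_of_forall_exists_isAffineOpen _ fun y ↦ ?_
    obtain ⟨i, hi⟩ := TopologicalSpace.Opens.mem_iSup.mp
      ((iSup_basicOpen_X_eq_top k m).ge (TopologicalSpace.Opens.mem_top y))
    refine ⟨_, hi, Proj.isAffineOpen_basicOpen _ _ (X_mem k i) one_pos, ?_⟩
    rw [projectionOn_preimage]
    exact (Proj.isAffineOpen_basicOpen _ _ (linForm_mem (L i)) one_pos).preimage ι

end
end LinProj

end

/-! ### Local rings of projective space -/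

noncomputable section

open Module IsLocalRing

namespace LinProj

/-- At a rational point, the maximal ideal of a localization of a finitely generated algebra is
generated by the generators of the algebra minus their values. -/
theorem exists_span_eq_maximalIdeal {k₀ B R ι : Type*} [CommRing k₀] [CommRing B] [CommRing R]
    [IsLocalRing R] [Algebra k₀ B] [Algebra B R] (P : Ideal B) [P.IsPrime]
    [IsLocalization.AtPrime R P] (b : ι → B) (hb : Algebra.adjoin k₀ (Set.range b) = ⊤)
    (hκ : Function.Bijective ((residue R).comp ((algebraMap B R).comp (algebraMap k₀ B)))) :
    ∃ a : ι → maximalIdeal R, Ideal.span (Set.range fun i ↦ (a i : R)) = maximalIdeal R := by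
  choose c hc using fun i ↦ hκ.2 (residue R (algebraMap B R (b i)))
  have hP (x : B) : x ∈ P ↔ residue R (algebraMap B R x) = 0 := by
    rw [residue_eq_zero_iff, IsLocalization.AtPrime.to_map_mem_maximal_iff R P x]
  set J := Ideal.span (Set.range fun i ↦ b i - algebraMap k₀ B (c i)) with hJ
  have hJP : J ≤ P := by
    rw [hJ, Ideal.span_le]
    rintro _ ⟨i, rfl⟩
    refine (hP _).mpr ?_
    rw [map_sub, map_sub, ← hc i]
    exact sub_self _
  have hconst (x : B) : ∃ t : k₀, x - algebraMap k₀ B t ∈ J := by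
    have hx : x ∈ Algebra.adjoin k₀ (Set.range b) := hb ▸ trivial
    induction hx using Algebra.adjoin_induction with
    | mem x hx =>
      obtain ⟨i, rfl⟩ := hx
      exact ⟨c i, Ideal.subset_span ⟨i, rfl⟩⟩
    | algebraMap t => exact ⟨t, by simp⟩
    | add x y _ _ hx hy =>
      obtain ⟨s, hs⟩ := hx
      obtain ⟨t, ht⟩ := hy
      exact ⟨s + t, by convert add_mem hs ht using 1; rw [map_add]; ring⟩
    | mul x y _ _ hx hy =>
      obtain ⟨s, hs⟩ := hx
      obtain ⟨t, ht⟩ := hy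
      refine ⟨s * t, ?_⟩
      convert add_mem (J.mul_mem_right y hs) (J.mul_mem_left (algebraMap k₀ B s) ht) using 1
      rw [map_mul]
      ring
  have hPJ : P = J := by
    refine le_antisymm (fun x hx ↦ ?_) hJP
    obtain ⟨t, ht⟩ := hconst x
    have h0 : t = 0 := hκ.1 <| by
      rw [map_zero]
      refine (hP _).mp ?_
      have := sub_mem hx (hJP ht)
      rwa [sub_sub_cancel] at this
    rwa [h0, map_zero, sub_zero] at ht
  have hmax := IsLocalization.AtPrime.map_eq_maximalIdeal P R
  have hspan : Ideal.span (Set.range fun i ↦ algebraMap B R (b i - algebraMap k₀ B (c i))) =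
      maximalIdeal R := by
    rw [← hmax, hPJ, hJ, Ideal.map_span, ← Set.range_comp]
    rfl
  exact ⟨fun i ↦ ⟨_, hspan.le (Ideal.subset_span ⟨i, rfl⟩)⟩, hspan⟩

attribute [local instance] MvPolynomial.gradedAlgebra

variable {k : Type u} [Field k] {m : ℕ}

/-- The coordinate function `X j / X i` on the chart `D₊(X i)`. -/
def chartCoord (k : Type u) [Field k] {N : ℕ} (i j : Fin (N + 1)) :
    HomogeneousLocalization.Away (grading k N) (MvPolynomial.X i) :=
  .mk _ (X_mem k i) 1 (MvPolynomial.X j) (by simpa using X_mem k j)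

theorem chartCoord_self (k : Type u) [Field k] {N : ℕ} (i : Fin (N + 1)) :
    chartCoord k i i = 1 := by
  ext
  simp only [chartCoord, HomogeneousLocalization.Away.val_mk, HomogeneousLocalization.val_one,
    pow_one]
  exact Localization.mk_self
    (⟨_, Submonoid.mem_powers _⟩ : Submonoid.powers (MvPolynomial.X i : MvPolynomial _ k))

theorem adjoin_chartCoord_eq_top (k : Type u) [Field k] {N : ℕ} (i : Fin (N + 2)) :
    Algebra.adjoin (grading k (N + 1) 0) (Set.range fun j ↦ chartCoord k i (i.succAbove j)) = ⊤ := by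
  rw [← top_le_iff, ← HomogeneousLocalization.Away.adjoin_mk_prod_pow_eq_top (X_mem k i)
    (Fin (N + 2)) MvPolynomial.X (adjoin_X_eq_top k (N + 1)) (fun _ ↦ 1) (fun j ↦ X_mem k j),
    Algebra.adjoin_le_iff]
  rintro _ ⟨a, ai, hai, -, rfl⟩
  have h : HomogeneousLocalization.Away.mk (grading k (N + 1)) (X_mem k i) a
      (∏ j, MvPolynomial.X j ^ ai j)
      (hai ▸ SetLike.prod_pow_mem_graded _ _ _ _ fun j _ ↦ X_mem k j) =
      ∏ j, chartCoord k i j ^ ai j := by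
    apply (show Function.Injective (algebraMap
      (HomogeneousLocalization.Away (grading k (N + 1)) (MvPolynomial.X i))
        (Localization.Away (MvPolynomial.X i : MvPolynomial (Fin (N + 2)) k)))
      from HomogeneousLocalization.val_injective _)
    rw [map_prod]
    simp only [map_pow, chartCoord, HomogeneousLocalization.algebraMap_apply,
      HomogeneousLocalization.Away.val_mk, Localization.mk_pow, Localization.mk_prod]
    congr 1
    refine Subtype.ext ?_
    simp only [pow_one, SubmonoidClass.coe_finsetProd, SubmonoidClass.coe_pow]
    rw [Finset.prod_pow_eq_pow_sum]
    exact congrArg (fun e ↦ (MvPolynomial.X i : MvPolynomial (Fin (N + 2)) k) ^ e)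
      (by simpa using hai.symm)
  rw [h]
  refine prod_mem fun j _ ↦ pow_mem ?_ _
  obtain rfl | ⟨j, rfl⟩ := Fin.eq_self_or_eq_succAbove i j
  · rw [chartCoord_self]
    exact one_mem _
  · exact Algebra.subset_adjoin ⟨j, rfl⟩

theorem fromSpec_basicOpen {N d : ℕ} {f : MvPolynomial (Fin (N + 1)) k} (hf : f ∈ grading k N d)
    (hd : 0 < d) :
    (Proj.isAffineOpen_basicOpen (grading k N) f hf hd).fromSpec =
      Spec.map (Proj.awayToSection (grading k N) f) ≫ Proj.awayι (grading k N) f hf hd := by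
  have : IsIso (Proj.basicOpen (grading k N) f).toSpecΓ := by
    rw [← (Proj.isAffineOpen_basicOpen (grading k N) f hf hd).isoSpec_hom]
    infer_instance
  rw [← cancel_epi (Proj.basicOpen (grading k N) f).toSpecΓ, IsAffineOpen.toSpecΓ_fromSpec,
    ← basicOpenToSpec_awayι hf hd, Proj.basicOpenToSpec, Category.assoc]

/-- The local ring at a closed point of projective space is regular, in the form needed here: its
maximal ideal has as many generators as the dimension `N + 1`. -/
theorem exists_span_eq_maximalIdeal_stalk [IsAlgClosed k] {N : ℕ} (y : PSpace k (N + 1))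
    (hy : IsClosed {y}) :
    ∃ a : Fin (N + 1) → maximalIdeal ((PSpace k (N + 1)).presheaf.stalk y),
      Ideal.span (Set.range fun i ↦ (a i : (PSpace k (N + 1)).presheaf.stalk y)) =
        maximalIdeal ((PSpace k (N + 1)).presheaf.stalk y) := by
  obtain ⟨i, hi⟩ := TopologicalSpace.Opens.mem_iSup.mp
    ((iSup_basicOpen_X_eq_top k (N + 1)).ge (TopologicalSpace.Opens.mem_top y))
  have hV := Proj.isAffineOpen_basicOpen (grading k (N + 1)) _ (X_mem k i) one_pos
  set V := Proj.basicOpen (grading k (N + 1)) (MvPolynomial.X i)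
  let Φ := Proj.awayToSection (grading k (N + 1)) (MvPolynomial.X i)
  let : Algebra (grading k (N + 1) 0) Γ(PSpace k (N + 1), V) :=
    (Φ.hom.comp (algebraMap _ _)).toAlgebra
  let : Algebra Γ(PSpace k (N + 1), V) ((PSpace k (N + 1)).presheaf.stalk y) :=
    ((PSpace k (N + 1)).presheaf.germ V y hi).hom.toAlgebra
  have : IsLocalization.AtPrime ((PSpace k (N + 1)).presheaf.stalk y)
    (hV.primeIdealOf ⟨y, hi⟩).asIdeal := hV.isLocalization_stalk ⟨y, hi⟩
  let Ψ : HomogeneousLocalization.Away (grading k (N + 1)) (MvPolynomial.X i)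
      →ₐ[grading k (N + 1) 0] Γ(PSpace k (N + 1), V) := { Φ.hom with commutes' := fun _ ↦ rfl }
  have hΨ : Function.Surjective Ψ :=
    (ConcreteCategory.bijective_of_isIso
      (Proj.basicOpenIsoAway (grading k (N + 1)) _ (X_mem k i) one_pos).hom).2
  refine exists_span_eq_maximalIdeal (k₀ := grading k (N + 1) 0)
    (hV.primeIdealOf ⟨y, hi⟩).asIdeal (fun j ↦ Ψ (chartCoord k i (i.succAbove j))) ?_ ?_
  · have h := congrArg (Subalgebra.map Ψ) (adjoin_chartCoord_eq_top k i)
    rw [AlgHom.map_adjoin, Algebra.map_top, (AlgHom.range_eq_top Ψ).mpr hΨ, ← Set.range_comp] at h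
    exact h
  · have h := bijective_algebraMap_residueField (PSpace.toSpec k (N + 1)) y hy
    have h2 : toStalk (PSpace.toSpec k (N + 1)) y =
        CommRingCat.ofHom (algebraMap k (grading k (N + 1) 0)) ≫
          CommRingCat.ofHom (HomogeneousLocalization.fromZeroRingHom (grading k (N + 1)) _) ≫
          Φ ≫ (PSpace k (N + 1)).presheaf.germ V y hi := by
      apply Spec.map_injective
      rw [SpecMap_toStalk, ← hV.fromSpecStalk_eq_fromSpecStalk hi, IsAffineOpen.fromSpecStalk,
        fromSpec_basicOpen (X_mem k i) one_pos, PSpace.toSpec]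
      simp only [Category.assoc, Proj.awayι_toSpecZero_assoc, Spec.map_comp]
      rfl
    rw [h2] at h
    exact (Function.Bijective.of_comp_iff _ (bijective_algebraMap_grading_zero k (N + 1))).mp h

end LinProj

end

theorem proposition2p2 {k : Type u} [Field k] [IsAlgClosed k] [CharZero k] (n r d : ℕ)
    {X : Scheme.{u}} [IsIntegral X] (ι : X ⟶ LinProj.PSpace k r) [IsClosedImmersion ι]
    [SmoothOfRelativeDimension n (ι ≫ LinProj.PSpace.toSpec k r)]
    (L : Fin (n + 2) → Fin (r + 1) → k) (hL : LinearIndependent k L)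
    (hcenter : Disjoint (Set.range ι) (LinProj.center L))
    (π : X ⟶ LinProj.PSpace k (n + 1)) (hπ : π = LinProj.projectionOn L ι hcenter)
    (p : X) (hp : IsClosed {p}) (hd : LinProj.tangentRank π p + d = n) :
    let Z := π.fiber (π p)
    let s : Z ⟶ Spec (.of k) := π.fiberι (π p) ≫ ι ≫ LinProj.PSpace.toSpec k r
    IsFinite s ∧ (d + 1).choose ⌈(d : ℚ) / 2⌉₊ ≤ LinProj.degree s := by
  have hfin : IsFinite π := hπ ▸ LinProj.isFinite_projectionOn L ι hcenter
  have hs : ι ≫ LinProj.PSpace.toSpec k r = π ≫ LinProj.PSpace.toSpec k (n + 1) := by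
    rw [hπ, LinProj.projectionOn_toSpec]
  have hsm : SmoothOfRelativeDimension n (π ≫ LinProj.PSpace.toSpec k (n + 1)) :=
    hs ▸ ‹SmoothOfRelativeDimension n (ι ≫ LinProj.PSpace.toSpec k r)›
  have hy : IsClosed {π p} := by
    simpa using π.isClosedMap _ hp
  obtain ⟨a, ha⟩ := LinProj.exists_span_eq_maximalIdeal_stalk (π p) hy
  rw [hs]
  exact LinProj.isFinite_and_choose_le_degree_fiber π _ p hp a ha hd
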